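/- Let $0<\alpha<1$, $T>0$ and $\Omega=\{(x,t):0<x<1,\ 0<t<T\}$. For an absolutely continuous function $f$ on $[0,T]$ let $$D^\alpha f(t)=\frac1{1-\alpha}\int_0^t f'(s)\,e^{-\frac{\alpha}{1-\alpha}(t-s)}\,ds$$ be its Caputo–Fabrizio derivative. Let $g:\overline\Omega\to\mathbb R$ be continuous with $g(x,0)=0$ for $0\le x\le1$ and $g(0,t)=g(1,t)$ for $0\le t\le T$. Assume that $g_t\in L^1(\Omega)$ and that $g_x(\cdot,t)\in L^2(0,1)$ for almost every $t$; here $g(x,\cdot)$ is absolutely continuous on $[0,T]$ for almost every $x\in[0,1]$, and $g(\cdot,t)$ is absolutely continuous on $[0,1]$ for almost every $t\in[0,T]$. Call $u:\overline\Omega\to\mathbb R$ a regular solution if $u$ is continuous on $\overline\Omega$, $u(x,\cdot)$ is absolutely continuous on $[0,T]$ for each $x\in(0,1)$, $u(\cdot,t)$ is $C^2$ on $(0,1)$ for each $t\in(0,T)$ with $u_{xx}$ continuous on $\Omega$, and $$D^\alpha_t u(x,t)-u_{xx}(x,t)=g(x,t)\quad\text{in }\Omega,\qquad u(x,0)=0\quad(0\le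 x\le1),$$ $$u(0,t)=u(1,t)\quad(0\le t\le T),\qquad u_x(0,t)=0\quad(0<t<T),$$ where $u_x(0,t)$ is the one-sided derivative. Then there is exactly one regular solution on $\overline\Omega$, and it is given by $$u(x,t)=u_0(t)+\sum_{k=1}^\infty u_{1k}(t)\cos 2k\pi x+\sum_{k=1}^\infty u_{2k}(t)\,x\sin 2k\pi x ,$$ where both series converge absolutely at every point of $\overline\Omega$. Here, with $q_k=1+(2k\pi)^2(1-\alpha)$ and $$g_0(t)=2\int_0^1 g(x,t)(1-x)\,dx,\quad g_{1k}(t)=4\int_0^1 g(x,t)(1-x)\cos 2k\pi x\,dx,\quad g_{2k}(t)=4\int_0^1 g(x,t)\sin 2k\pi x\,dx,$$ the coefficients are $$u_0(t)=(1-\alpha)g_0(t)+\alpha\int_0^t g_0(z)\,dz,$$ $$u_{2k}(t)=\frac{1-\alpha}{q_k}g_{2k}(t)+\frac{\alpha}{q_k^2}\int_0^t g_{2k}(z)\,e^{-\frac{\alpha(2k\pi)^2(t-z)}{q_k}}\,dz,$$ $$u_{1k}(t)=\frac{1-\alpha}{q_k}\Big[g_{1k}(t)+\frac{4k\pi(1-\alpha)}{q_k}g_{2k}(t)\Big]+\frac{\alpha}{q_k^2}\int_0^t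 e^{-\frac{\alpha(2k\pi)^2(t-z)}{q_k}}\Big[g_{1k}(z)+\frac{8k\pi(1-\alpha)}{q_k}g_{2k}(z)+\frac{4k\pi\alpha}{q_k^2}g_{2k}(z)(t-z)\Big]dz .$$ Moreover, for every $k\ge1$, these functions are the unique absolutely continuous solutions on $[0,T]$ of the coupled initial value problems $$D^\alpha u_0=g_0,\quad u_0(0)=0;\qquad D^\alpha u_{2k}+(2k\pi)^2u_{2k}=g_{2k},\quad u_{2k}(0)=0;$$ $$D^\alpha u_{1k}+(2k\pi)^2u_{1k}=g_{1k}+4k\pi\,u_{2k},\quad u_{1k}(0)=0 .$$ -/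

import Mathlib

open MeasureTheory Set

noncomputable section

namespace CFHeat

/-- The Caputo–Fabrizio derivative of order `α` with base point `a`. -/
def cfDeriv (a α : ℝ) (f : ℝ → ℝ) (t : ℝ) : ℝ :=
  1 / (1 - α) * ∫ s in a..t, deriv f s * Real.exp (-(α / (1 - α)) * (t - s))

/-- `y` solves the initial value problem `D^α y + μ y = f` on `[0, T]`, `y 0 = 0`.
Absolute continuity is what makes the derivative under the integral in `cfDeriv` meaningful. -/
structure IsIVPSolution (α μ T : ℝ) (f y : ℝ → ℝ) : Prop where
  absCont : AbsolutelyContinuousOnInterval y 0 T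
  initial : y 0 = 0
  equation : ∀ t ∈ Icc (0 : ℝ) T, cfDeriv 0 α y t + μ * y t = f t

/-- `u` is a regular solution, in the rectangle `0 < x < 1`, `0 < t < T`, of the equation
`D_t^α u - u_xx = g` with `u (x, 0) = 0`, `u (0, t) = u (1, t)` and `u_x (0, t) = 0`: it is
continuous on the closed rectangle, absolutely continuous in `t`, and twice differentiable in `x`
with `u_xx` continuous in the open rectangle. -/
structure IsRegularSolution (α T : ℝ) (g u : ℝ → ℝ → ℝ) : Prop where
  cont : ContinuousOn (fun p : ℝ × ℝ => u p.1 p.2) (Icc 0 1 ×ˢ Icc 0 T)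
  absCont : ∀ x ∈ Ioo (0 : ℝ) 1, AbsolutelyContinuousOnInterval (u x) 0 T
  contDiff : ∀ t ∈ Ioo (0 : ℝ) T, ContDiffOn ℝ 2 (fun x => u x t) (Ioo 0 1)
  cont_xx : ContinuousOn (fun p : ℝ × ℝ => iteratedDeriv 2 (fun x => u x p.2) p.1)
    (Ioo 0 1 ×ˢ Ioo 0 T)
  equation : ∀ x ∈ Ioo (0 : ℝ) 1, ∀ t ∈ Ioo (0 : ℝ) T,
    cfDeriv 0 α (u x) t - iteratedDeriv 2 (fun y => u y t) x = g x t
  initial : ∀ x ∈ Icc (0 : ℝ) 1, u x 0 = 0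
  nonlocal : ∀ t ∈ Icc (0 : ℝ) T, u 0 t = u 1 t
  -- one-sided derivative at the left end point
  neumann : ∀ t ∈ Ioo (0 : ℝ) T, HasDerivWithinAt (fun x => u x t) 0 (Icc 0 1) 0

/-- The frequency `2kπ`. -/
def freq (k : ℕ) : ℝ := 2 * k * Real.pi

/-- Coefficient of `g (·, t)` at the root function `1`. -/
def g0 (g : ℝ → ℝ → ℝ) (t : ℝ) : ℝ :=
  2 * ∫ x in (0 : ℝ)..1, g x t * (1 - x)

/-- Coefficient of `g (·, t)` at the root function `cos (2kπx)`. -/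
def g1 (g : ℝ → ℝ → ℝ) (k : ℕ) (t : ℝ) : ℝ :=
  4 * ∫ x in (0 : ℝ)..1, g x t * (1 - x) * Real.cos (freq k * x)

/-- Coefficient of `g (·, t)` at the root function `x sin (2kπx)`. -/
def g2 (g : ℝ → ℝ → ℝ) (k : ℕ) (t : ℝ) : ℝ :=
  4 * ∫ x in (0 : ℝ)..1, g x t * Real.sin (freq k * x)

/-- The number `1 + (2kπ)² (1 - α)`. -/
def den (α : ℝ) (k : ℕ) : ℝ := 1 + freq k ^ 2 * (1 - α)

/-- The exponential `exp (-α (2kπ)² r / (1 + (2kπ)² (1 - α)))`. -/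
def decay (α : ℝ) (k : ℕ) (r : ℝ) : ℝ :=
  Real.exp (-(α * freq k ^ 2 * r / den α k))

/-- Coefficient of the solution at `1`. -/
def u0 (α : ℝ) (g : ℝ → ℝ → ℝ) (t : ℝ) : ℝ :=
  (1 - α) * g0 g t + α * ∫ z in (0 : ℝ)..t, g0 g z

/-- Coefficient of the solution at `cos (2kπx)`. -/
def u1 (α : ℝ) (g : ℝ → ℝ → ℝ) (k : ℕ) (t : ℝ) : ℝ :=
  (1 - α) / den α k * (g1 g k t + 4 * k * Real.pi * (1 - α) / den α k * g2 g k t) +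
    α / den α k ^ 2 * ∫ z in (0 : ℝ)..t, decay α k (t - z) *
      (g1 g k z + 8 * k * Real.pi * (1 - α) / den α k * g2 g k z +
        4 * k * Real.pi * α / den α k ^ 2 * g2 g k z * (t - z))

/-- Coefficient of the solution at `x sin (2kπx)`. -/
def u2 (α : ℝ) (g : ℝ → ℝ → ℝ) (k : ℕ) (t : ℝ) : ℝ :=
  (1 - α) / den α k * g2 g k t +
    α / den α k ^ 2 * ∫ z in (0 : ℝ)..t, g2 g k z * decay α k (t - z)

end CFHeat

end

noncomputable section

namespace CFHeat

open Real intervalIntegral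

/-! ### Absolutely continuous functions -/

/-! For absolutely continuous `y` with `y 0 = 0`, integration by parts removes the derivative from
`cfDeriv`: with `a = α / (1 - α)` it equals `(y - a * memory a y) / (1 - α)`. Each initial value
problem thus becomes a Volterra equation with exponential kernel. Since `memory a y` solves `m' = y
- a m`, uniqueness reduces to a scalar linear ODE (`eq_of_volterra`), and `volt` is an explicit
solution.

In space, the functions `1 - x`, `(1 - x) cos`, `sin` are biorthogonal to `1`, `cos`, `x sin`. The
coefficients determine a continuous function with equal end values: vanishing sine integrals force
symmetry about `1/2`, and for a symmetric function the weight `1 - x` averages to `1/2`, so all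
ordinary Fourier coefficients vanish (`eq_zero_of_coef`). The test functions satisfy the adjoint
boundary conditions, so two integrations by parts turn `v'' = h`, `v'(0) = 0`, `v(0) = v(1)` into
algebraic relations between the coefficients of `v` and `h`. Conversely, these relations force `v`
to be a constant plus the double primitive of `h`.

Uniqueness: the coefficients of a regular solution satisfy the Volterra equations, hence are `u0`,
`u1`, `u2`, and these determine the solution. Existence: the coefficients are `O(1 / den)`, hence
`O(k⁻²)`, which gives uniform convergence but does not by itself justify differentiating twice term
by term. Instead the sum and the function `rhs` built from it satisfy the coefficient relations, so
the sum is a constant plus the double primitive of a continuous function; regularity, the equation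
and the Neumann condition follow. Absolute continuity in time comes from dominating all increments
by those of one function, built from the primitive of the spatial `L¹` norm of `g_t`. -/

theorem absolutelyContinuous_of_dominated {f F : ℝ → ℝ} {T : ℝ} (hT : 0 ≤ T)
    (hF : AbsolutelyContinuousOnInterval F 0 T)
    (h : ∀ s ∈ Icc 0 T, ∀ t ∈ Icc 0 T, s ≤ t → |f t - f s| ≤ F t - F s) :
    AbsolutelyContinuousOnInterval f 0 T := by
  rw [absolutelyContinuousOnInterval_iff] at hF ⊢
  intro ε hε
  obtain ⟨δ, hδ, H⟩ := hF ε hε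
  refine ⟨δ, hδ, fun E hE hl => lt_of_le_of_lt (Finset.sum_le_sum fun i hi => ?_) (H E hE hl)⟩
  have hm := hE.1 i hi
  rw [uIcc_of_le hT] at hm
  rw [Real.dist_eq, Real.dist_eq]
  rcases le_total (E.2 i).1 (E.2 i).2 with hle | hle
  · rw [abs_sub_comm, abs_sub_comm (F _)]
    exact (h _ hm.1 _ hm.2 hle).trans (le_abs_self _)
  · exact (h _ hm.2 _ hm.1 hle).trans (le_abs_self _)

theorem absolutelyContinuous_congr {f F : ℝ → ℝ} {T : ℝ} (hT : 0 ≤ T)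
    (hF : AbsolutelyContinuousOnInterval F 0 T) (h : EqOn f F (Icc 0 T)) :
    AbsolutelyContinuousOnInterval f 0 T := by
  rw [absolutelyContinuousOnInterval_iff] at hF ⊢
  intro ε hε
  obtain ⟨δ, hδ, H⟩ := hF ε hε
  refine ⟨δ, hδ, fun E hE hl => lt_of_le_of_lt (Finset.sum_le_sum fun i hi => ?_) (H E hE hl)⟩
  have hm := hE.1 i hi
  rw [uIcc_of_le hT] at hm
  rw [h hm.1, h hm.2]

theorem absolutelyContinuous_mono {f : ℝ → ℝ} {s t T : ℝ} (hs : s ∈ Icc 0 T) (ht : t ∈ Icc 0 T)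
    (hf : AbsolutelyContinuousOnInterval f 0 T) : AbsolutelyContinuousOnInterval f s t := by
  rw [absolutelyContinuousOnInterval_iff] at hf ⊢
  intro ε hε
  obtain ⟨δ, hδ, H⟩ := hf ε hε
  refine ⟨δ, hδ, fun E hE hl => H E (AbsolutelyContinuousOnInterval.disjWithin_mono ?_ hE) hl⟩
  rw [uIcc_of_le (hs.1.trans hs.2)]
  exact uIcc_subset_Icc hs ht

/-! ### The exponential memory term -/

/-- The convolution of `y` with the exponential kernel of rate `a`. -/
def memory (a : ℝ) (y : ℝ → ℝ) (t : ℝ) : ℝ := ∫ s in (0 : ℝ)..t, y s * exp (-a * (t - s))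

theorem memory_zero (a : ℝ) (y : ℝ → ℝ) : memory a y 0 = 0 := by simp [memory]

theorem memory_eq (a : ℝ) (y : ℝ → ℝ) (t : ℝ) :
    memory a y t = exp (-a * t) * ∫ s in (0 : ℝ)..t, y s * exp (a * s) := by
  rw [memory, ← intervalIntegral.integral_const_mul]
  congr 1; ext s
  rw [show -a * (t - s) = -a * t + a * s by ring, exp_add]; ring

theorem memory_congr {a : ℝ} {y z : ℝ → ℝ} {t T : ℝ} (h : EqOn y z (Icc 0 T)) (ht : t ∈ Icc 0 T) :
    memory a y t = memory a z t := by
  refine intervalIntegral.integral_congr fun s hs => ?_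
  rw [uIcc_of_le ht.1] at hs
  simp only [h ⟨hs.1, hs.2.trans ht.2⟩]

/-- The kernel factors as `exp (-a t) exp (a s)`, so the product rule gives the linear ODE behind
all uniqueness arguments below. -/
theorem hasDerivAt_memory {y : ℝ → ℝ} (hy : Continuous y) (a t : ℝ) :
    HasDerivAt (memory a y) (y t - a * memory a y t) t := by
  have h1 : HasDerivAt (fun t => ∫ s in (0 : ℝ)..t, y s * exp (a * s)) (y t * exp (a * t)) t :=
    integral_hasDerivAt_right ((by fun_prop : Continuous _).intervalIntegrable _ _)
      ((by fun_prop : Continuous _).stronglyMeasurableAtFilter _ _)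
      (by fun_prop : Continuous _).continuousAt
  have h2 : HasDerivAt (fun t => exp (-a * t)) (exp (-a * t) * (-a)) t := by
    simpa using ((hasDerivAt_id t).const_mul (-a)).exp
  have h3 := h2.mul h1
  have hfun : memory a y = fun t => exp (-a * t) * ∫ s in (0 : ℝ)..t, y s * exp (a * s) :=
    funext (memory_eq a y)
  rw [hfun]
  refine h3.congr_deriv ?_
  have : exp (-a * t) * exp (a * t) = 1 := by rw [← exp_add]; simp
  linear_combination y t * this

theorem continuous_memory {y : ℝ → ℝ} (hy : Continuous y) (a : ℝ) : Continuous (memory a y) :=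
  continuous_iff_continuousAt.2 fun t => (hasDerivAt_memory hy a t).continuousAt

theorem abs_memory_le {y : ℝ → ℝ} {a t T Y : ℝ} (ha : 0 ≤ a)
    (hY : ∀ s ∈ Icc 0 T, |y s| ≤ Y) (ht : t ∈ Icc 0 T) : |memory a y t| ≤ Y * T := by
  have h0 : 0 ≤ Y := (abs_nonneg _).trans (hY t ht)
  have := intervalIntegral.norm_integral_le_of_norm_le_const (a := 0) (b := t) (C := Y)
    (f := fun s => y s * exp (-a * (t - s))) (fun s hs => by
      rw [uIoc_of_le ht.1] at hs
      rw [norm_mul, norm_eq_abs, norm_eq_abs, abs_exp]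
      have h1 : exp (-a * (t - s)) ≤ 1 := by
        rw [exp_le_one_iff]; nlinarith [hs.2]
      calc |y s| * exp (-a * (t - s)) ≤ Y * 1 :=
            mul_le_mul (hY s ⟨hs.1.le, hs.2.trans ht.2⟩) h1 (exp_pos _).le h0
        _ = Y := mul_one Y)
  rw [sub_zero, abs_of_nonneg ht.1] at this
  exact this.trans (mul_le_mul_of_nonneg_left ht.2 h0)

theorem abs_memory_sub_le {y : ℝ → ℝ} (hy : Continuous y) {a s t T Y : ℝ} (ha : 0 ≤ a)
    (hY : ∀ s ∈ Icc 0 T, |y s| ≤ Y) (hs : s ∈ Icc 0 T) (ht : t ∈ Icc 0 T) (hst : s ≤ t) :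
    |memory a y t - memory a y s| ≤ Y * (1 + a * T) * (t - s) := by
  have h := (convex_Icc 0 T).norm_image_sub_le_of_norm_hasDerivWithin_le
    (f := memory a y) (C := Y * (1 + a * T))
    (fun x _ => (hasDerivAt_memory hy a x).hasDerivWithinAt) (fun x hx => by
      have h1 := hY x hx
      have h2 := abs_memory_le ha hY hx
      calc ‖y x - a * memory a y x‖ ≤ |y x| + |a * memory a y x| := abs_sub _ _
        _ = |y x| + a * |memory a y x| := by rw [abs_mul, abs_of_nonneg ha]
        _ ≤ Y + a * (Y * T) := by gcongr
        _ = _ := by ring) hs ht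
  rwa [norm_eq_abs, norm_eq_abs, abs_of_nonneg (sub_nonneg.2 hst)] at h

/-- The integrating factor `exp (-c t)` makes the derivative zero; the mean value theorem on `[0,
t]` does the rest. -/
theorem eq_zero_of_hasDerivAt_mul {D : ℝ → ℝ} {c T : ℝ} (hD : ContinuousOn D (Icc 0 T))
    (h0 : D 0 = 0) (h : ∀ t ∈ Ioo 0 T, HasDerivAt D (c * D t) t) : ∀ t ∈ Icc 0 T, D t = 0 := by
  intro t ht
  rcases ht.1.eq_or_lt with rfl | hpos
  · exact h0
  obtain ⟨ξ, -, hξ⟩ := exists_hasDerivAt_eq_slope (fun t => D t * exp (-c * t)) (fun _ => 0) hpos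
    (((hD.mono (Icc_subset_Icc_right ht.2)).mul (by fun_prop))) (fun x hx => by
      have h2 : HasDerivAt (fun t => exp (-c * t)) (exp (-c * x) * (-c)) x := by
        simpa using ((hasDerivAt_id x).const_mul (-c)).exp
      refine ((h x ⟨hx.1, hx.2.trans_le ht.2⟩).mul h2).congr_deriv ?_
      ring)
  simp only [h0, zero_mul, sub_zero] at hξ
  rw [eq_comm, div_eq_zero_iff] at hξ
  rcases hξ with hξ | hξ
  · exact (mul_eq_zero.1 hξ).resolve_right (exp_pos _).ne'
  · exact absurd hξ hpos.ne'

/-- If `D` is the difference of the memory terms, the two equations give `q (y - z) = a D`, hence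
`D' = (a / q - a) D` with `D 0 = 0`. The equations are required only on the open interval, where the
PDE holds; continuity supplies the end points. -/
theorem eq_of_volterra {y z f : ℝ → ℝ} {a b q T : ℝ} (hy : Continuous y) (hz : Continuous z)
    (hq : q ≠ 0) (hey : ∀ t ∈ Ioo 0 T, q * y t = b * f t + a * memory a y t)
    (hez : ∀ t ∈ Ioo 0 T, q * z t = b * f t + a * memory a z t) (hT : 0 < T) :
    EqOn y z (Icc 0 T) := by
  have hc : Continuous fun t => memory a y t - memory a z t :=
    (continuous_memory hy a).sub (continuous_memory hz a)
  have hD := eq_zero_of_hasDerivAt_mul (D := fun t => memory a y t - memory a z t)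
    (c := a / q - a) (T := T) hc.continuousOn (by simp [memory_zero]) (fun t ht => by
      refine ((hasDerivAt_memory hy a t).sub (hasDerivAt_memory hz a t)).congr_deriv ?_
      field_simp
      linear_combination hey t ht - hez t ht)
  have hI : EqOn y z (Ioo 0 T) := fun t ht => by
    have := hD t (Ioo_subset_Icc_self ht)
    refine mul_left_cancel₀ hq ?_
    linear_combination hey t ht - hez t ht + a * this
  have := hI.closure hy hz
  rwa [closure_Ioo hT.ne] at this

/-! ### The solution of the linear Volterra equation -/

/-- The solution of `D^α y + μ y = f`, `y 0 = 0`. -/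
def volt (α μ : ℝ) (f : ℝ → ℝ) (t : ℝ) : ℝ :=
  (1 - α) / (1 + μ * (1 - α)) * f t +
    α / (1 + μ * (1 - α)) ^ 2 * memory (α * μ / (1 + μ * (1 - α))) f t

theorem continuous_volt {f : ℝ → ℝ} (hf : Continuous f) (α μ : ℝ) : Continuous (volt α μ f) := by
  have := continuous_memory hf (α * μ / (1 + μ * (1 - α)))
  unfold volt
  fun_prop

theorem den_pos {α μ : ℝ} (hα1 : α < 1) (hμ : 0 ≤ μ) : 1 ≤ 1 + μ * (1 - α) := by
  nlinarith [mul_nonneg hμ (sub_pos.2 hα1).le]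

/-- The difference `D` of the two sides vanishes at `0` and satisfies `D' = -(α / (1 - α)) D`; the
coefficients match because `q = 1 + μ (1 - α)` yields `e2`. -/
theorem memory_volt {α μ : ℝ} (hα1 : α < 1) (hμ : 0 ≤ μ) {f : ℝ → ℝ}
    (hf : Continuous f) {t : ℝ} (ht : 0 ≤ t) :
    memory (α / (1 - α)) (volt α μ f) t =
      (1 - α) / (1 + μ * (1 - α)) * memory (α * μ / (1 + μ * (1 - α))) f t := by
  have hq : 1 + μ * (1 - α) ≠ 0 := by have := den_pos hα1 hμ; positivity
  have h1 : 1 - α ≠ 0 := (sub_pos.2 hα1).ne'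
  have hv := continuous_volt hf α μ
  have hc1 := continuous_memory hv (α / (1 - α))
  have hc2 := continuous_memory hf (α * μ / (1 + μ * (1 - α)))
  have h := eq_zero_of_hasDerivAt_mul (T := t) (c := -(α / (1 - α)))
    (D := fun t => memory (α / (1 - α)) (volt α μ f) t -
      (1 - α) / (1 + μ * (1 - α)) * memory (α * μ / (1 + μ * (1 - α))) f t)
    (by fun_prop) (by simp [memory_zero]) (fun s _ => by
      refine ((hasDerivAt_memory hv _ s).sub
        ((hasDerivAt_memory hf _ s).const_mul _)).congr_deriv ?_
      generalize memory (α / (1 - α)) (volt α μ f) s = m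
      unfold volt
      generalize memory (α * μ / (1 + μ * (1 - α))) f s = n
      have e1 : α / (1 - α) * (1 - α) = α := div_mul_cancel₀ _ h1
      have e2 : α / (1 + μ * (1 - α)) ^ 2 +
          (1 - α) / (1 + μ * (1 - α)) * (α * μ / (1 + μ * (1 - α))) =
          α / (1 + μ * (1 - α)) := by
        rw [div_mul_div_comm, ← pow_two, ← add_div, div_eq_div_iff (by positivity) hq]
        ring
      linear_combination n * e2 - n / (1 + μ * (1 - α)) * e1) t ⟨ht, le_rfl⟩
  exact sub_eq_zero.1 h

/-- This is `D^α y + μ y = f` after integration by parts, multiplied by `1 - α`. -/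
theorem volt_volterra {α μ : ℝ} (hα1 : α < 1) (hμ : 0 ≤ μ) {f : ℝ → ℝ}
    (hf : Continuous f) {t : ℝ} (ht : 0 ≤ t) :
    (1 + μ * (1 - α)) * volt α μ f t =
      (1 - α) * f t + α / (1 - α) * memory (α / (1 - α)) (volt α μ f) t := by
  have hq : 1 + μ * (1 - α) ≠ 0 := by have := den_pos hα1 hμ; positivity
  have h1 : 1 - α ≠ 0 := (sub_pos.2 hα1).ne'
  rw [memory_volt hα1 hμ hf ht, volt]
  field_simp

/-- The gain is the denominator: for `μ = freq k ^ 2` it supplies the decay that makes the series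
converge. -/
theorem abs_volt_le {α μ : ℝ} (hα : 0 < α) (hα1 : α < 1) (hμ : 0 ≤ μ) {f : ℝ → ℝ} {T F t : ℝ}
    (hF : ∀ s ∈ Icc 0 T, |f s| ≤ F) (ht : t ∈ Icc 0 T) :
    |volt α μ f t| ≤ F * (1 + T) / (1 + μ * (1 - α)) := by
  have hq := den_pos hα1 hμ
  set q := 1 + μ * (1 - α)
  have h0 : 0 ≤ F := (abs_nonneg _).trans (hF t ht)
  have hT : 0 ≤ T := ht.1.trans ht.2
  have hm := abs_memory_le (a := α * μ / q) (by positivity) hF ht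
  have h1 : 0 ≤ 1 - α := by linarith
  calc |volt α μ f t| ≤ |(1 - α) / q * f t| + |α / q ^ 2 * memory (α * μ / q) f t| := abs_add_le _ _
    _ = (1 - α) / q * |f t| + α / q ^ 2 * |memory (α * μ / q) f t| := by
        rw [abs_mul, abs_mul, abs_of_nonneg (by positivity : 0 ≤ (1 - α) / q),
          abs_of_nonneg (by positivity : 0 ≤ α / q ^ 2)]
    _ ≤ 1 / q * F + 1 / q * (F * T) := by
        gcongr ?_ / _ * ?_ + ?_ * ?_
        · linarith
        · exact hF t ht
        · rw [div_le_div_iff₀ (by positivity) (by positivity)]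
          nlinarith
    _ = _ := by ring

/-- Subtracting the Volterra equation at two times, rather than the explicit formula, keeps the
factor `1 / q` and gives constants independent of `μ`: the memory of a bounded function is
Lipschitz. -/
theorem abs_volt_sub_le {α μ : ℝ} (hα : 0 < α) (hα1 : α < 1) (hμ : 0 ≤ μ) {f : ℝ → ℝ}
    (hf : Continuous f) {T F s t : ℝ}
    (hF : ∀ s ∈ Icc 0 T, |f s| ≤ F) (hs : s ∈ Icc 0 T) (ht : t ∈ Icc 0 T) (hst : s ≤ t) :
    |volt α μ f t - volt α μ f s| ≤
      (|f t - f s| + α / (1 - α) * (1 + α / (1 - α) * T) * (1 + T) * F * (t - s)) /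
        (1 + μ * (1 - α)) := by
  have hq := den_pos hα1 hμ
  have h1 : 0 < 1 - α := by linarith
  have h0 : 0 ≤ F := (abs_nonneg _).trans (hF t ht)
  have hT : 0 ≤ T := ht.1.trans ht.2
  have e1 := volt_volterra hα1 hμ hf hs.1
  have e2 := volt_volterra hα1 hμ hf ht.1
  have ha : 0 ≤ α / (1 - α) := by positivity
  have hm := abs_memory_sub_le (continuous_volt hf α μ) ha
    (fun s hs => (abs_volt_le hα hα1 hμ hF hs).trans
      (div_le_self (by positivity) hq)) hs ht hst
  set q := 1 + μ * (1 - α)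
  set a := α / (1 - α)
  have hq0 : 0 < q := by linarith
  rw [le_div_iff₀ hq0]
  calc |volt α μ f t - volt α μ f s| * q = |(volt α μ f t - volt α μ f s) * q| := by
        rw [abs_mul, abs_of_pos hq0]
    _ = |(1 - α) * (f t - f s) + a * (memory a (volt α μ f) t - memory a (volt α μ f) s)| := by
        congr 1; linear_combination e2 - e1
    _ ≤ (1 - α) * |f t - f s| + a * |memory a (volt α μ f) t - memory a (volt α μ f) s| := by
        refine (abs_add_le _ _).trans_eq ?_
        rw [abs_mul, abs_mul, abs_of_pos h1, abs_of_nonneg ha]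
    _ ≤ 1 * |f t - f s| + a * (F * (1 + T) * (1 + a * T) * (t - s)) := by
        gcongr
        linarith
    _ = _ := by ring

/-! ### The Caputo–Fabrizio derivative and its initial value problems -/

/-- Integration by parts for absolutely continuous functions: the boundary term at `s = t` is `y t`,
the one at `0` vanishes, and differentiating the kernel in `s` brings out the rate. -/
theorem cfDeriv_eq_memory {α T t : ℝ} {y : ℝ → ℝ} (hy : AbsolutelyContinuousOnInterval y 0 T)
    (h0 : y 0 = 0) (ht : t ∈ Icc 0 T) :
    cfDeriv 0 α y t = (y t - α / (1 - α) * memory (α / (1 - α)) y t) / (1 - α) := by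
  have hyt := absolutelyContinuous_mono ⟨le_rfl, ht.1.trans ht.2⟩ ht hy
  set a := α / (1 - α) with ha
  have hder : ∀ s, HasDerivAt (fun s => exp (-a * (t - s))) (a * exp (-a * (t - s))) s := by
    intro s
    have := (((hasDerivAt_id s).const_sub t).const_mul (-a)).exp
    refine this.congr_deriv ?_
    simp; ring
  have hE : AbsolutelyContinuousOnInterval (fun s => exp (-a * (t - s))) 0 t :=
    ContDiffOn.absolutelyContinuousOnInterval (by fun_prop)
  have h := hE.integral_mul_deriv_eq_deriv_mul hyt
  have e1 : ∫ s in (0 : ℝ)..t, deriv y s * exp (-a * (t - s)) =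
      ∫ s in (0 : ℝ)..t, exp (-a * (t - s)) * deriv y s := by
    congr 1; ext s; ring
  have e2 : ∫ s in (0 : ℝ)..t, deriv (fun s => exp (-a * (t - s))) s * y s =
      a * memory a y t := by
    rw [memory, ← intervalIntegral.integral_const_mul]
    congr 1; ext s; rw [(hder s).deriv]; ring
  rw [cfDeriv, ← ha, e1, h, e2, h0]
  simp
  ring

theorem memory_IccExtend {a T t : ℝ} (hT : 0 ≤ T) (y : ℝ → ℝ) (ht : t ∈ Icc 0 T) :
    memory a (IccExtend hT (fun s : Icc 0 T => y s)) t = memory a y t :=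
  memory_congr (T := T) (fun s hs => by rw [IccExtend_of_mem hT _ hs]) ht

/-- The compatibility condition `f 0 = 0` is what makes `volt` vanish at time `0`. -/
theorem isIVPSolution_volt {α μ T : ℝ} (hα1 : α < 1) (hμ : 0 ≤ μ) {f : ℝ → ℝ}
    (hf : Continuous f) (hf0 : f 0 = 0) (hac : AbsolutelyContinuousOnInterval (volt α μ f) 0 T) :
    IsIVPSolution α μ T f (volt α μ f) := by
  have h0 : volt α μ f 0 = 0 := by simp [volt, memory_zero, hf0]
  refine ⟨hac, h0, fun t ht => ?_⟩
  have h1 : 1 - α ≠ 0 := (sub_pos.2 hα1).ne'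
  have h := volt_volterra hα1 hμ hf ht.1
  rw [cfDeriv_eq_memory hac h0 ht, div_add' _ _ _ h1, div_eq_iff h1]
  linear_combination h

theorem IsIVPSolution.eqOn_volt {α μ T : ℝ} (hα1 : α < 1) (hμ : 0 ≤ μ) (hT : 0 < T)
    {f y : ℝ → ℝ} (hf : Continuous f) (hy : IsIVPSolution α μ T f y) :
    EqOn y (volt α μ f) (Icc 0 T) := by
  have hq : 1 + μ * (1 - α) ≠ 0 := by have := den_pos hα1 hμ; positivity
  have h1 : 1 - α ≠ 0 := (sub_pos.2 hα1).ne'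
  have hyc := hy.absCont.continuousOn
  rw [uIcc_of_le hT.le] at hyc
  have hext : EqOn (IccExtend hT.le (fun s : Icc 0 T => y s)) y (Icc 0 T) :=
    fun s hs => IccExtend_of_mem hT.le _ hs
  refine hext.symm.trans (eq_of_volterra (b := 1 - α) (a := α / (1 - α)) (f := f)
    (continuousOn_iff_continuous_domRestrict.1 hyc).Icc_extend' (continuous_volt hf α μ) hq
    (fun t ht => ?_) (fun t ht => volt_volterra hα1 hμ hf ht.1.le) hT)
  have ht' := Ioo_subset_Icc_self ht
  have h := hy.equation t ht'
  rw [cfDeriv_eq_memory hy.absCont hy.initial ht', div_add' _ _ _ h1, div_eq_iff h1] at h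
  rw [memory_IccExtend hT.le y ht', hext ht']
  linear_combination h

/-- Two-sided derivatives at the end points could see values outside `[0, T]`, but only the open
interval matters for the integral. -/
theorem cfDeriv_congr {α T t : ℝ} {y z : ℝ → ℝ} (h : EqOn y z (Icc 0 T)) (ht : t ∈ Icc 0 T) :
    cfDeriv 0 α y t = cfDeriv 0 α z t := by
  rw [cfDeriv, cfDeriv]
  congr 1
  refine intervalIntegral.integral_congr_Ioo_of_le ht.1 fun s hs => ?_
  have : y =ᶠ[nhds s] z := by
    filter_upwards [Ioo_mem_nhds hs.1 (hs.2.trans_le ht.2)] with r hr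
    exact h (Ioo_subset_Icc_self hr)
  simp only [this.deriv_eq]

theorem IsIVPSolution.congr {α μ T : ℝ} (hT : 0 ≤ T) {f f' y y' : ℝ → ℝ}
    (h : IsIVPSolution α μ T f y) (hf : EqOn f' f (Icc 0 T)) (hy : EqOn y' y (Icc 0 T)) :
    IsIVPSolution α μ T f' y' where
  absCont := absolutelyContinuous_congr hT h.absCont hy
  initial := by rw [hy ⟨le_rfl, hT⟩, h.initial]
  equation t ht := by rw [cfDeriv_congr hy ht, hy ht, hf ht, h.equation t ht]

/-! ### Trigonometric integrals over the unit interval -/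

theorem cos_freq_reflect (k : ℕ) (x : ℝ) : cos (freq k * (1 - x)) = cos (freq k * x) := by
  rw [show freq k * (1 - x) = k * (2 * π) - freq k * x by unfold freq; ring,
    cos_nat_mul_two_pi_sub]

theorem sin_freq_reflect (k : ℕ) (x : ℝ) : sin (freq k * (1 - x)) = -sin (freq k * x) := by
  rw [show freq k * (1 - x) = k * (2 * π) - freq k * x by unfold freq; ring,
    sin_nat_mul_two_pi_sub]

/-- Averaging over `x ↦ 1 - x`. Since `x + (1 - x) = 1`, this removes the linear weights from
integrals of symmetric functions. -/
theorem two_mul_integral_eq_of_reflect {F H : ℝ → ℝ} (hF : IntervalIntegrable F volume 0 1)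
    (h : ∀ x ∈ Icc (0 : ℝ) 1, F x + F (1 - x) = H x) :
    2 * ∫ x in (0 : ℝ)..1, F x = ∫ x in (0 : ℝ)..1, H x := by
  have e : ∫ x in (0 : ℝ)..1, F (1 - x) = ∫ x in (0 : ℝ)..1, F x := by
    rw [intervalIntegral.integral_comp_sub_left]; simp
  have hF' : IntervalIntegrable (fun x => F (1 - x)) volume 0 1 := by
    simpa using (hF.comp_sub_left 1).symm
  rw [two_mul]
  nth_rewrite 2 [← e]
  rw [← intervalIntegral.integral_add hF hF']
  refine intervalIntegral.integral_congr fun x hx => h x ?_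
  rwa [uIcc_of_le zero_le_one] at hx

theorem integral_cos_two_pi_mul {m : ℤ} (hm : m ≠ 0) :
    ∫ x in (0 : ℝ)..1, cos (2 * π * m * x) = 0 := by
  have hc : 2 * π * (m : ℝ) ≠ 0 := by positivity
  rw [intervalIntegral.integral_comp_mul_left _ hc, integral_cos]
  have : sin (2 * π * m * 1) = 0 := by
    rw [show 2 * π * (m : ℝ) * 1 = ((2 * m : ℤ) : ℝ) * π by push_cast; ring]
    exact sin_int_mul_pi _
  rw [this]; simp

theorem integral_cos_freq {k : ℕ} (hk : k ≠ 0) : ∫ x in (0 : ℝ)..1, cos (freq k * x) = 0 := by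
  refine Eq.trans ?_ (integral_cos_two_pi_mul (m := k) (by exact_mod_cast hk))
  congr 1; ext x; unfold freq; congr 1; push_cast; ring

theorem integral_cos_mul_cos (j k : ℕ) (hk : k ≠ 0) :
    ∫ x in (0 : ℝ)..1, cos (freq j * x) * cos (freq k * x) = if j = k then 1 / 2 else 0 := by
  have e : ∀ x, cos (freq j * x) * cos (freq k * x) =
      (cos (2 * π * ((j - k : ℤ) : ℝ) * x) + cos (2 * π * ((j + k : ℤ) : ℝ) * x)) / 2 := by
    intro x
    rw [show 2 * π * ((j - k : ℤ) : ℝ) * x = freq j * x - freq k * x by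
        unfold freq; push_cast; ring,
      show 2 * π * ((j + k : ℤ) : ℝ) * x = freq j * x + freq k * x by
        unfold freq; push_cast; ring, cos_sub, cos_add]
    ring
  simp_rw [e]
  rw [intervalIntegral.integral_div, intervalIntegral.integral_add
    ((by fun_prop : Continuous _).intervalIntegrable _ _)
    ((by fun_prop : Continuous _).intervalIntegrable _ _),
    integral_cos_two_pi_mul (by omega : (j + k : ℤ) ≠ 0)]
  split_ifs with h
  · subst h; simp
  · rw [integral_cos_two_pi_mul (by omega : (j - k : ℤ) ≠ 0)]; simp

theorem integral_sin_mul_sin (j k : ℕ) (hk : k ≠ 0) :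
    ∫ x in (0 : ℝ)..1, sin (freq j * x) * sin (freq k * x) = if j = k then 1 / 2 else 0 := by
  have e : ∀ x, sin (freq j * x) * sin (freq k * x) =
      (cos (2 * π * ((j - k : ℤ) : ℝ) * x) - cos (2 * π * ((j + k : ℤ) : ℝ) * x)) / 2 := by
    intro x
    rw [show 2 * π * ((j - k : ℤ) : ℝ) * x = freq j * x - freq k * x by
        unfold freq; push_cast; ring,
      show 2 * π * ((j + k : ℤ) : ℝ) * x = freq j * x + freq k * x by
        unfold freq; push_cast; ring, cos_sub, cos_add]
    ring
  simp_rw [e]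
  rw [intervalIntegral.integral_div, intervalIntegral.integral_sub
    ((by fun_prop : Continuous _).intervalIntegrable _ _)
    ((by fun_prop : Continuous _).intervalIntegrable _ _),
    integral_cos_two_pi_mul (by omega : (j + k : ℤ) ≠ 0)]
  split_ifs with h
  · subst h; simp
  · rw [integral_cos_two_pi_mul (by omega : (j - k : ℤ) ≠ 0)]; simp

/-! ### The biorthogonal coefficients -/

/-- Coefficient of `f` at the root function `1`. -/
def coef0 (f : ℝ → ℝ) : ℝ := 2 * ∫ x in (0 : ℝ)..1, f x * (1 - x)

/-- Coefficient of `f` at the root function `cos (2kπx)`. -/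
def coef1 (f : ℝ → ℝ) (k : ℕ) : ℝ := 4 * ∫ x in (0 : ℝ)..1, f x * (1 - x) * cos (freq k * x)

/-- Coefficient of `f` at the root function `x sin (2kπx)`. -/
def coef2 (f : ℝ → ℝ) (k : ℕ) : ℝ := 4 * ∫ x in (0 : ℝ)..1, f x * sin (freq k * x)

/-- Equal end values let `φ` descend to a continuous function on the circle. Its Fourier
coefficients all vanish, hence are summable, so the series converges pointwise to `φ` and to zero.
-/
theorem eq_zero_of_fourier {φ : ℝ → ℝ} (hc : ContinuousOn φ (Icc 0 1)) (hp : φ 0 = φ 1)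
    (hcos : ∀ k : ℕ, ∫ x in (0 : ℝ)..1, φ x * cos (freq k * x) = 0)
    (hsin : ∀ k : ℕ, ∫ x in (0 : ℝ)..1, φ x * sin (freq k * x) = 0) :
    ∀ x ∈ Icc (0 : ℝ) 1, φ x = 0 := by
  have : Fact ((0 : ℝ) < 1) := ⟨zero_lt_one⟩
  have hii : ∀ ψ : ℝ → ℝ, Continuous ψ → IntervalIntegrable (fun x => φ x * ψ x) volume 0 1 :=
    fun ψ hψ => (ContinuousOn.mul (by rwa [uIcc_of_le zero_le_one])
      hψ.continuousOn).intervalIntegrable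
  let F : C(AddCircle (1 : ℝ), ℂ) := ⟨AddCircle.liftIco 1 0 (fun x => (φ x : ℂ)),
    AddCircle.liftIco_zero_continuous (by rw [hp])
      (Complex.continuous_ofReal.comp_continuousOn hc)⟩
  have hcoef : ∀ n : ℤ, fourierCoeff F n = 0 := by
    intro n
    have h1 : fourierCoeff F n = _ := fourierCoeff_liftIco_eq (T := 1) (a := 0)
      (fun x => (φ x : ℂ)) n
    rw [h1, fourierCoeffOn_eq_integral]
    have h2 : ∀ m : ℤ, ∫ x in (0 : ℝ)..1, φ x * cos (2 * π * m * x) = 0 := by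
      intro m
      obtain ⟨k, rfl | rfl⟩ := m.eq_nat_or_neg
      · refine Eq.trans ?_ (hcos k)
        congr 1; ext x; unfold freq; congr 2; push_cast; ring
      · refine Eq.trans ?_ (hcos k)
        congr 1; ext x; unfold freq; rw [← cos_neg]; congr 2; push_cast; ring
    have h3 : ∀ m : ℤ, ∫ x in (0 : ℝ)..1, φ x * sin (2 * π * m * x) = 0 := by
      intro m
      obtain ⟨k, rfl | rfl⟩ := m.eq_nat_or_neg
      · refine Eq.trans ?_ (hsin k)
        congr 1; ext x; unfold freq; congr 2; push_cast; ring
      · rw [← neg_eq_zero, ← intervalIntegral.integral_neg]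
        refine Eq.trans ?_ (hsin k)
        congr 1; ext x; unfold freq; rw [← mul_neg, ← sin_neg]; congr 2; push_cast; ring
    have h4 : ∫ x in (0 : ℝ)..(0 + 1), fourier (-n) (x : AddCircle ((0 : ℝ) + 1 - 0)) • (φ x : ℂ) =
        ∫ x in (0 : ℝ)..1, (((φ x * cos (2 * π * ((-n : ℤ) : ℝ) * x) : ℝ) : ℂ) +
          ((φ x * sin (2 * π * ((-n : ℤ) : ℝ) * x) : ℝ) : ℂ) * Complex.I) := by
      rw [zero_add]
      congr 1; ext x
      rw [fourier_coe_apply, smul_eq_mul]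
      have : (2 * π * Complex.I * ((-n : ℤ) : ℂ) * x / ((1 - 0 : ℝ) : ℂ) : ℂ) =
          ((2 * π * ((-n : ℤ) : ℝ) * x : ℝ) : ℂ) * Complex.I := by
        push_cast; ring
      rw [this, Complex.exp_mul_I, ← Complex.ofReal_cos, ← Complex.ofReal_sin]
      push_cast; ring
    have hC : Continuous fun x : ℝ => cos (2 * π * ((-n : ℤ) : ℝ) * x) := by fun_prop
    have hS : Continuous fun x : ℝ => sin (2 * π * ((-n : ℤ) : ℝ) * x) := by fun_prop
    rw [h4, intervalIntegral.integral_add, intervalIntegral.integral_mul_const,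
      intervalIntegral.integral_ofReal, intervalIntegral.integral_ofReal, h2, h3]
    · simp
    · exact ⟨(hii _ hC).1.ofReal, (hii _ hC).2.ofReal⟩
    · exact IntervalIntegrable.mul_const ⟨(hii _ hS).1.ofReal, (hii _ hS).2.ofReal⟩ _
  have hfun : fourierCoeff F = fun _ => 0 := funext hcoef
  have hsum := has_pointwise_sum_fourier_series_of_summable (f := F)
    (by rw [hfun]; exact summable_zero)
  have hF : ∀ y, F y = 0 := fun y => by
    refine (hsum y).unique ?_
    simp only [hcoef, zero_smul]
    exact hasSum_zero
  have hIco : ∀ x ∈ Ico (0 : ℝ) 1, φ x = 0 := by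
    intro x hx
    have h5 := hF (x : AddCircle (1 : ℝ))
    have h6 : F (x : AddCircle (1 : ℝ)) = (φ x : ℂ) :=
      AddCircle.liftIco_zero_coe_apply (f := fun x => (φ x : ℂ)) hx
    rw [h6] at h5
    exact_mod_cast h5
  intro x hx
  rcases hx.2.lt_or_eq with h | rfl
  · exact hIco x ⟨hx.1, h⟩
  · rw [← hp]; exact hIco 0 ⟨le_rfl, zero_lt_one⟩

theorem eq_zero_of_coef {f : ℝ → ℝ} (hc : ContinuousOn f (Icc 0 1)) (hp : f 0 = f 1)
    (h0 : coef0 f = 0) (h1 : ∀ k, 1 ≤ k → coef1 f k = 0) (h2 : ∀ k, 1 ≤ k → coef2 f k = 0) :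
    ∀ x ∈ Icc (0 : ℝ) 1, f x = 0 := by
  have hii : ∀ ψ : ℝ → ℝ, Continuous ψ → IntervalIntegrable (fun x => f x * ψ x) volume 0 1 :=
    fun ψ hψ => (ContinuousOn.mul (by rwa [uIcc_of_le zero_le_one])
      hψ.continuousOn).intervalIntegrable
  have hmap : MapsTo (fun x : ℝ => 1 - x) (Icc 0 1) (Icc 0 1) := fun x hx =>
    ⟨by linarith [hx.2], by linarith [hx.1]⟩
  have hcr : ContinuousOn (fun x => f (1 - x)) (Icc 0 1) := hc.comp (by fun_prop) hmap
  have hii' : ∀ ψ : ℝ → ℝ, Continuous ψ →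
      IntervalIntegrable (fun x => f (1 - x) * ψ x) volume 0 1 :=
    fun ψ hψ => (ContinuousOn.mul (by rwa [uIcc_of_le zero_le_one])
      hψ.continuousOn).intervalIntegrable
  have hsin : ∀ k : ℕ, ∫ x in (0 : ℝ)..1, f x * sin (freq k * x) = 0 := by
    intro k
    rcases Nat.eq_zero_or_pos k with rfl | hk
    · simp [freq]
    · have := h2 k hk; unfold coef2 at this; linarith
  -- The antisymmetric part has zero cosine integrals by parity, and its sine integrals are twice
  -- those of `f`; so `f` is symmetric about `1/2`.
  have hodd : ∀ x ∈ Icc (0 : ℝ) 1, f x - f (1 - x) = 0 := by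
    refine eq_zero_of_fourier (φ := fun x => f x - f (1 - x)) (hc.sub hcr) (by simp [hp])
      (fun k => ?_) (fun k => ?_)
    · have hI : IntervalIntegrable (fun x => (f x - f (1 - x)) * cos (freq k * x)) volume 0 1 := by
        simp_rw [sub_mul]
        exact (hii _ (by fun_prop)).sub (hii' _ (by fun_prop))
      have := two_mul_integral_eq_of_reflect hI (H := fun _ => 0) (fun x _ => by
        rw [cos_freq_reflect, sub_sub_cancel]; ring)
      simpa using this
    · have := two_mul_integral_eq_of_reflect (hii _ (by fun_prop : Continuous fun x =>
        sin (freq k * x))) (H := fun x => (f x - f (1 - x)) * sin (freq k * x)) (fun x _ => by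
        rw [sin_freq_reflect]; ring)
      rw [← this, hsin, mul_zero]
  refine eq_zero_of_fourier hc hp (fun k => ?_) hsin
  have hI : IntervalIntegrable (fun x => f x * (1 - x) * cos (freq k * x)) volume 0 1 := by
    simp_rw [mul_assoc]
    exact hii _ (by fun_prop)
  -- By this symmetry the weight `1 - x` averages to `1/2`, so the weighted cosine integrals
  -- determine the plain ones; `k = 0` is covered by `coef0`.
  have := two_mul_integral_eq_of_reflect hI (H := fun x => f x * cos (freq k * x)) (fun x hx => by
    rw [cos_freq_reflect, sub_sub_cancel]
    linear_combination -x * cos (freq k * x) * hodd x hx)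
  rw [← this]
  rcases Nat.eq_zero_or_pos k with rfl | hk
  · simpa [freq, coef0] using h0
  · have := h1 k hk; unfold coef1 at this; linarith

/-! ### The coefficients of a series of root functions -/

section Series

variable {c : ℝ} {A B : ℕ → ℝ}

theorem hasSum_integral_series {r : ℕ → ℝ} (hr : Summable r) {F : ℕ → ℝ → ℝ} {φ : ℝ → ℝ}
    (hF : ∀ k, Continuous (F k)) (hb : ∀ k, ∀ x ∈ Icc (0 : ℝ) 1, |F k x| ≤ r k)
    (hφ : Continuous φ) :
    HasSum (fun k => ∫ x in (0 : ℝ)..1, F k x * φ x) (∫ x in (0 : ℝ)..1, (∑' k, F k x) * φ x) := by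
  refine intervalIntegral.hasSum_integral_of_dominated_convergence (fun k x => r k * |φ x|)
    (fun k => (by have := hF k; fun_prop : Continuous fun x => F k x * φ x).aestronglyMeasurable)
    (fun k => .of_forall fun x hx => ?_) (.of_forall fun x _ => hr.mul_right _)
    ?_
    (.of_forall fun x hx => ?_)
  · rw [uIoc_of_le zero_le_one] at hx
    rw [norm_mul]
    exact mul_le_mul_of_nonneg_right (hb k x (Ioc_subset_Icc_self hx)) (norm_nonneg _)
  · have : Continuous fun x => (∑' k, r k) * |φ x| := by fun_prop
    simp_rw [tsum_mul_right]
    exact this.intervalIntegrable _ _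
  · rw [uIoc_of_le zero_le_one] at hx
    have hs : Summable fun k => F k x := Summable.of_norm_bounded hr fun k =>
      (norm_eq_abs (F k x)).trans_le (hb k x (Ioc_subset_Icc_self hx))
    exact hs.hasSum.mul_right (φ x)

/-- The series with coefficients `c`, `A`, `B` in the root functions. -/
def series (c : ℝ) (A B : ℕ → ℝ) (x : ℝ) : ℝ :=
  c + (∑' k, A k * cos (freq (k + 1) * x)) + ∑' k, B k * (x * sin (freq (k + 1) * x))

theorem abs_mul_cos_le (a y : ℝ) : |a * cos y| ≤ |a| := by
  rw [abs_mul]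
  exact mul_le_of_le_one_right (abs_nonneg _) (abs_cos_le_one _)

theorem abs_mul_mul_sin_le (a y : ℝ) {x : ℝ} (hx : x ∈ Icc (0 : ℝ) 1) :
    |a * (x * sin y)| ≤ |a| := by
  rw [abs_mul]
  refine mul_le_of_le_one_right (abs_nonneg _) ?_
  rw [abs_mul, abs_of_nonneg hx.1]
  exact mul_le_one₀ hx.2 (abs_nonneg _) (abs_sin_le_one _)

theorem hasSum_integral_series_mul (hA : Summable fun k => |A k|) (hB : Summable fun k => |B k|)
    {φ : ℝ → ℝ} (hφ : Continuous φ) :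
    ∫ x in (0 : ℝ)..1, series c A B x * φ x = c * (∫ x in (0 : ℝ)..1, φ x) +
      (∑' k, A k * ∫ x in (0 : ℝ)..1, cos (freq (k + 1) * x) * φ x) +
      ∑' k, B k * ∫ x in (0 : ℝ)..1, x * sin (freq (k + 1) * x) * φ x := by
  have h1 := hasSum_integral_series hA (F := fun k x => A k * cos (freq (k + 1) * x))
    (fun k => by fun_prop) (fun k x _ => abs_mul_cos_le (A k) (freq (k + 1) * x)) hφ
  have h2 := hasSum_integral_series hB (F := fun k x => B k * (x * sin (freq (k + 1) * x)))
    (fun k => by fun_prop) (fun k x hx => abs_mul_mul_sin_le (B k) (freq (k + 1) * x) hx) hφ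
  have c1 : ContinuousOn (fun x => ∑' k, A k * cos (freq (k + 1) * x)) (uIcc 0 1) :=
    continuousOn_tsum (fun k => by fun_prop) hA
      (fun k x _ => (norm_eq_abs _).trans_le (abs_mul_cos_le (A k) (freq (k + 1) * x)))
  have c2 : ContinuousOn (fun x => ∑' k, B k * (x * sin (freq (k + 1) * x))) (uIcc 0 1) :=
    continuousOn_tsum (fun k => by fun_prop) hB (fun k x hx => (norm_eq_abs _).trans_le
      (abs_mul_mul_sin_le (B k) (freq (k + 1) * x) (by rwa [uIcc_of_le zero_le_one] at hx)))
  simp only [series, add_mul]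
  rw [intervalIntegral.integral_add, intervalIntegral.integral_add, ← h1.tsum_eq, ← h2.tsum_eq,
    intervalIntegral.integral_const_mul]
  · simp_rw [mul_assoc, intervalIntegral.integral_const_mul]
  · exact (by fun_prop : Continuous _).intervalIntegrable _ _
  · exact (c1.mul hφ.continuousOn).intervalIntegrable
  · exact (((continuous_const.mul hφ).continuousOn.add
      (c1.mul hφ.continuousOn))).intervalIntegrable
  · exact (c2.mul hφ.continuousOn).intervalIntegrable

theorem integral_mul_one_sub {ψ : ℝ → ℝ} (hψ : Continuous ψ) (h : ∀ x, ψ (1 - x) = ψ x) :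
    ∫ x in (0 : ℝ)..1, ψ x * (1 - x) = (∫ x in (0 : ℝ)..1, ψ x) / 2 := by
  rw [← two_mul_integral_eq_of_reflect (F := fun x => ψ x * (1 - x)) (H := ψ)
    ((by fun_prop : Continuous _).intervalIntegrable _ _) (fun x _ => by rw [h]; ring)]
  ring

theorem integral_mul_id {ψ : ℝ → ℝ} (hψ : Continuous ψ) (h : ∀ x, ψ (1 - x) = ψ x) :
    ∫ x in (0 : ℝ)..1, x * ψ x = (∫ x in (0 : ℝ)..1, ψ x) / 2 := by
  rw [← two_mul_integral_eq_of_reflect (F := fun x => x * ψ x) (H := ψ)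
    ((by fun_prop : Continuous _).intervalIntegrable _ _) (fun x _ => by rw [h]; ring)]
  ring

theorem integral_eq_zero_of_odd {ψ : ℝ → ℝ} (hψ : Continuous ψ) (h : ∀ x, ψ (1 - x) = -ψ x) :
    ∫ x in (0 : ℝ)..1, ψ x = 0 := by
  have := two_mul_integral_eq_of_reflect (F := ψ) (H := fun _ => 0)
    (hψ.intervalIntegrable _ _) (fun x _ => by rw [h]; ring)
  simpa using this

/-- Biorthogonality, as in the next two results: each product is either odd under `x ↦ 1 - x`, or
even up to a linear weight that averages to `1/2`, leaving classical orthogonality. `A k` and `B k`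
belong to the frequency of index `k + 1`. -/
theorem coef0_series (hA : Summable fun k => |A k|) (hB : Summable fun k => |B k|) :
    coef0 (series c A B) = c := by
  rw [coef0, hasSum_integral_series_mul hA hB (by fun_prop)]
  have e1 : ∀ k : ℕ, ∫ x in (0 : ℝ)..1, cos (freq (k + 1) * x) * (1 - x) = 0 := fun k => by
    rw [integral_mul_one_sub (by fun_prop) (cos_freq_reflect _), integral_cos_freq (by omega),
      zero_div]
  have e2 : ∀ k : ℕ, ∫ x in (0 : ℝ)..1, x * sin (freq (k + 1) * x) * (1 - x) = 0 := fun k =>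
    integral_eq_zero_of_odd (by fun_prop) (fun x => by rw [sin_freq_reflect]; ring)
  have e3 : ∫ x in (0 : ℝ)..1, (1 - x) = 1 / 2 := by
    have := integral_mul_one_sub (ψ := fun _ => 1) continuous_const (fun _ => rfl)
    simpa using this
  simp only [e1, e2, e3, mul_zero, tsum_zero]
  ring

theorem coef1_series (hA : Summable fun k => |A k|) (hB : Summable fun k => |B k|) (k : ℕ) :
    coef1 (series c A B) (k + 1) = A k := by
  have e0 : coef1 (series c A B) (k + 1) =
      4 * ∫ x in (0 : ℝ)..1, series c A B x * (cos (freq (k + 1) * x) * (1 - x)) := by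
    rw [coef1]; congr 2; ext x; ring
  rw [e0, hasSum_integral_series_mul hA hB (by fun_prop)]
  have e1 : ∀ j : ℕ, ∫ x in (0 : ℝ)..1, cos (freq (j + 1) * x) *
      (cos (freq (k + 1) * x) * (1 - x)) = if j = k then 1 / 4 else 0 := fun j => by
    simp_rw [← mul_assoc]
    rw [integral_mul_one_sub (ψ := fun x => cos (freq (j + 1) * x) * cos (freq (k + 1) * x))
      (by fun_prop) (fun x => by rw [cos_freq_reflect, cos_freq_reflect]),
      integral_cos_mul_cos _ _ (by omega)]
    simp only [Nat.add_right_cancel_iff]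
    split_ifs <;> norm_num
  have e2 : ∀ j : ℕ, ∫ x in (0 : ℝ)..1, x * sin (freq (j + 1) * x) *
      (cos (freq (k + 1) * x) * (1 - x)) = 0 := fun j =>
    integral_eq_zero_of_odd (by fun_prop)
      (fun x => by rw [sin_freq_reflect, cos_freq_reflect]; ring)
  have e3 : ∫ x in (0 : ℝ)..1, cos (freq (k + 1) * x) * (1 - x) = 0 := by
    rw [integral_mul_one_sub (by fun_prop) (cos_freq_reflect _), integral_cos_freq (by omega),
      zero_div]
  simp only [e1, e2, e3, mul_zero, tsum_zero, mul_ite, tsum_ite_eq]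
  ring

theorem coef2_series (hA : Summable fun k => |A k|) (hB : Summable fun k => |B k|) (k : ℕ) :
    coef2 (series c A B) (k + 1) = B k := by
  rw [coef2, hasSum_integral_series_mul hA hB (by fun_prop)]
  have e1 : ∀ j : ℕ, ∫ x in (0 : ℝ)..1, cos (freq (j + 1) * x) * sin (freq (k + 1) * x) = 0 :=
    fun j => integral_eq_zero_of_odd (by fun_prop)
      (fun x => by rw [sin_freq_reflect, cos_freq_reflect]; ring)
  have e2 : ∀ j : ℕ, ∫ x in (0 : ℝ)..1, x * sin (freq (j + 1) * x) * sin (freq (k + 1) * x) =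
      if j = k then 1 / 4 else 0 := fun j => by
    simp_rw [mul_assoc]
    rw [integral_mul_id (ψ := fun x => sin (freq (j + 1) * x) * sin (freq (k + 1) * x))
      (by fun_prop) (fun x => by rw [sin_freq_reflect, sin_freq_reflect]; ring),
      integral_sin_mul_sin _ _ (by omega)]
    simp only [Nat.add_right_cancel_iff]
    split_ifs <;> norm_num
  have e3 : ∫ x in (0 : ℝ)..1, sin (freq (k + 1) * x) = 0 :=
    integral_eq_zero_of_odd (by fun_prop) (sin_freq_reflect _)
  simp only [e1, e2, e3, mul_zero, tsum_zero, mul_ite, tsum_ite_eq]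
  ring

end Series

/-! ### The boundary value problem in the space variable -/

theorem freq_pos {k : ℕ} (hk : 1 ≤ k) : 0 < freq k := by
  have : (0 : ℝ) < k := by exact_mod_cast hk
  unfold freq; positivity

theorem cos_freq (k : ℕ) : cos (freq k) = 1 := by
  have := cos_freq_reflect k 0
  simpa using this

theorem sin_freq (k : ℕ) : sin (freq k) = 0 := by
  have := sin_freq_reflect k 0
  simpa using this

theorem coef0_sub {f h : ℝ → ℝ} (hf : ContinuousOn f (Icc 0 1)) (hh : ContinuousOn h (Icc 0 1)) :
    coef0 (fun x => f x - h x) = coef0 f - coef0 h := by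
  rw [← uIcc_of_le zero_le_one] at hf hh
  simp only [coef0, sub_mul]
  rw [intervalIntegral.integral_sub, mul_sub]
  · exact (hf.mul (by fun_prop)).intervalIntegrable
  · exact (hh.mul (by fun_prop)).intervalIntegrable

theorem coef1_sub {f h : ℝ → ℝ} (hf : ContinuousOn f (Icc 0 1)) (hh : ContinuousOn h (Icc 0 1))
    (k : ℕ) : coef1 (fun x => f x - h x) k = coef1 f k - coef1 h k := by
  rw [← uIcc_of_le zero_le_one] at hf hh
  simp only [coef1, sub_mul]
  rw [intervalIntegral.integral_sub, mul_sub]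
  · exact ((hf.mul (by fun_prop)).mul (by fun_prop)).intervalIntegrable
  · exact ((hh.mul (by fun_prop)).mul (by fun_prop)).intervalIntegrable

theorem coef2_sub {f h : ℝ → ℝ} (hf : ContinuousOn f (Icc 0 1)) (hh : ContinuousOn h (Icc 0 1))
    (k : ℕ) : coef2 (fun x => f x - h x) k = coef2 f k - coef2 h k := by
  rw [← uIcc_of_le zero_le_one] at hf hh
  simp only [coef2, sub_mul]
  rw [intervalIntegral.integral_sub, mul_sub]
  · exact (hf.mul (by fun_prop)).intervalIntegrable
  · exact (hh.mul (by fun_prop)).intervalIntegrable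

/-- The coefficients separate continuous functions with equal boundary values. -/
theorem eqOn_of_coef_eq {f h : ℝ → ℝ} (hf : ContinuousOn f (Icc 0 1))
    (hh : ContinuousOn h (Icc 0 1)) (hfp : f 0 = f 1) (hhp : h 0 = h 1) (h0 : coef0 f = coef0 h)
    (h1 : ∀ k, 1 ≤ k → coef1 f k = coef1 h k) (h2 : ∀ k, 1 ≤ k → coef2 f k = coef2 h k) :
    EqOn f h (Icc 0 1) := fun x hx => by
  refine sub_eq_zero.1 (eq_zero_of_coef (f := fun x => f x - h x) (hf.sub hh)
    (by simp only [hfp, hhp]) ?_ ?_ ?_ x hx)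
  · rw [coef0_sub hf hh, h0, sub_self]
  · intro k hk; rw [coef1_sub hf hh, h1 k hk, sub_self]
  · intro k hk; rw [coef2_sub hf hh, h2 k hk, sub_self]

theorem coef_congr {f h : ℝ → ℝ} (H : EqOn f h (Icc 0 1)) :
    coef0 f = coef0 h ∧ coef1 f = coef1 h ∧ coef2 f = coef2 h := by
  have H' : ∀ x ∈ uIcc (0 : ℝ) 1, f x = h x := fun x hx => H (by rwa [uIcc_of_le zero_le_one] at hx)
  refine ⟨?_, funext fun k => ?_, funext fun k => ?_⟩
  all_goals
    simp only [coef0, coef1, coef2]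
    congr 1
    exact intervalIntegral.integral_congr fun x hx => by simp only [H' x hx]

/-- The second antiderivative of `h` that vanishes to first order at `0`. -/
def antideriv2 (h : ℝ → ℝ) (x : ℝ) : ℝ := ∫ y in (0 : ℝ)..x, ∫ z in (0 : ℝ)..y, h z

theorem antideriv2_zero (h : ℝ → ℝ) : antideriv2 h 0 = 0 := by simp [antideriv2]

theorem hasDerivAt_primitive {h : ℝ → ℝ} (hh : Continuous h) (x : ℝ) : HasDerivAt (fun x => ∫ z in (0 : ℝ)..x, h z) (h x) x :=
  integral_hasDerivAt_right (hh.intervalIntegrable _ _) (hh.stronglyMeasurableAtFilter _ _)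
    hh.continuousAt

theorem continuous_primitive {h : ℝ → ℝ} (hh : Continuous h) : Continuous fun x => ∫ z in (0 : ℝ)..x, h z :=
  continuous_iff_continuousAt.2 fun x => (hasDerivAt_primitive hh x).continuousAt

theorem hasDerivAt_antideriv2 {h : ℝ → ℝ} (hh : Continuous h) (x : ℝ) :
    HasDerivAt (antideriv2 h) (∫ z in (0 : ℝ)..x, h z) x :=
  hasDerivAt_primitive (continuous_primitive hh) x

theorem continuous_antideriv2 {h : ℝ → ℝ} (hh : Continuous h) : Continuous (antideriv2 h) :=
  continuous_primitive (continuous_primitive hh)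

theorem deriv_antideriv2 {h : ℝ → ℝ} (hh : Continuous h) : deriv (antideriv2 h) = fun x => ∫ z in (0 : ℝ)..x, h z :=
  funext fun x => (hasDerivAt_antideriv2 hh x).deriv

theorem iteratedDeriv_two_antideriv2 {h : ℝ → ℝ} (hh : Continuous h) : iteratedDeriv 2 (antideriv2 h) = h := by
  rw [iteratedDeriv_succ, iteratedDeriv_one, deriv_antideriv2 hh]
  exact funext fun x => (hasDerivAt_primitive hh x).deriv

theorem contDiff_antideriv2 {h : ℝ → ℝ} (hh : Continuous h) : ContDiff ℝ 2 (antideriv2 h) := by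
  have h1 : ContDiff ℝ 1 (fun x => ∫ z in (0 : ℝ)..x, h z) := by
    rw [contDiff_one_iff_deriv]
    refine ⟨fun x => (hasDerivAt_primitive hh x).differentiableAt, ?_⟩
    rwa [show deriv (fun x => ∫ z in (0 : ℝ)..x, h z) = h from
      funext fun x => (hasDerivAt_primitive hh x).deriv]
  rw [show (2 : WithTop ℕ∞) = 1 + 1 by norm_num, contDiff_succ_iff_deriv]
  refine ⟨fun x => (hasDerivAt_antideriv2 hh x).differentiableAt, by simp, ?_⟩
  rwa [deriv_antideriv2 hh]

/-- Two integrations by parts against `V = antideriv2 h`. The condition `p 1 = 0` kills `V' 1`,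
while `V' 0 = 0` handles the other end; `p' 0 = p' 1` removes the constant `c`. These are the
adjoint boundary conditions, met by `1 - x`, `sin` and `(1 - x) cos`. -/
theorem integral_mul_antideriv2 {h : ℝ → ℝ} (hh : Continuous h) (c : ℝ) {p p' p'' : ℝ → ℝ}
    (hp : ∀ x, HasDerivAt p (p' x) x) (hp' : ∀ x, HasDerivAt p' (p'' x) x)
    (hp'' : Continuous p'') (h1 : p 1 = 0) (h01 : p' 0 = p' 1) :
    ∫ x in (0 : ℝ)..1, h x * p x =
      -(antideriv2 h 1 * p' 1) + ∫ x in (0 : ℝ)..1, (c + antideriv2 h x) * p'' x := by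
  have cp : Continuous p := continuous_iff_continuousAt.2 fun x => (hp x).continuousAt
  have cV := continuous_antideriv2 hh
  have key := integral_eq_sub_of_hasDerivAt (a := 0) (b := 1)
    (f := fun x => (∫ z in (0 : ℝ)..x, h z) * p x - (c + antideriv2 h x) * p' x)
    (f' := fun x => h x * p x - (c + antideriv2 h x) * p'' x)
    (fun x _ => (((hasDerivAt_primitive hh x).mul (hp x)).sub
      (((hasDerivAt_antideriv2 hh x).const_add c).mul (hp' x))).congr_deriv (by ring))
    ((by fun_prop : Continuous _).intervalIntegrable _ _)
  rw [intervalIntegral.integral_sub ((by fun_prop : Continuous _).intervalIntegrable _ _)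
    ((by fun_prop : Continuous _).intervalIntegrable _ _), antideriv2_zero h, h1, h01] at key
  simp only [integral_same] at key
  linear_combination key

/-- For `p = 1 - x` only the boundary term survives, so a zero mean coefficient amounts to equal end
values of the double primitive. -/
theorem coef0_antideriv2 {h : ℝ → ℝ} (hh : Continuous h) : coef0 h = 2 * antideriv2 h 1 := by
  have := integral_mul_antideriv2 hh 0 (p := fun x => 1 - x) (p' := fun _ => -1)
    (p'' := fun _ => 0) (fun x => by simpa using (hasDerivAt_id x).const_sub 1)
    (fun x => hasDerivAt_const x _) continuous_const (by simp) rfl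
  rw [coef0, this]; simp

theorem coef2_antideriv2 {h : ℝ → ℝ} (hh : Continuous h) (hV : antideriv2 h 1 = 0) (c : ℝ) (k : ℕ) :
    coef2 h k = -freq k ^ 2 * coef2 (fun x => c + antideriv2 h x) k := by
  have hl : ∀ x, HasDerivAt (fun x => freq k * x) (freq k) x := fun x => by
    simpa using (hasDerivAt_id x).const_mul (freq k)
  have := integral_mul_antideriv2 hh c (p := fun x => sin (freq k * x))
    (p' := fun x => freq k * cos (freq k * x)) (p'' := fun x => -freq k ^ 2 * sin (freq k * x))
    (fun x => (hl x).sin.congr_deriv (by ring))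
    (fun x => ((hl x).cos.const_mul (freq k)).congr_deriv (by ring)) (by fun_prop)
    (by simp [sin_freq]) (by simp [cos_freq])
  have e : ∀ x, (c + antideriv2 h x) * (-freq k ^ 2 * sin (freq k * x)) =
      -freq k ^ 2 * ((c + antideriv2 h x) * sin (freq k * x)) := fun x => by ring
  simp_rw [e] at this
  rw [coef2, this, hV, intervalIntegral.integral_const_mul, coef2]
  ring

/-- Differentiating `(1 - x) cos` twice leaves an extra sine. This is the origin of the coupling
term `4 * k * π * u2`. -/
theorem coef1_antideriv2 {h : ℝ → ℝ} (hh : Continuous h) (hV : antideriv2 h 1 = 0) (c : ℝ) (k : ℕ) :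
    coef1 h k = 2 * freq k * coef2 (fun x => c + antideriv2 h x) k -
      freq k ^ 2 * coef1 (fun x => c + antideriv2 h x) k := by
  have hl : ∀ x, HasDerivAt (fun x => freq k * x) (freq k) x := fun x => by
    simpa using (hasDerivAt_id x).const_mul (freq k)
  have hs : ∀ x, HasDerivAt (fun x : ℝ => 1 - x) (-1) x := fun x => by
    simpa using (hasDerivAt_id x).const_sub 1
  have cV := continuous_antideriv2 hh
  have := integral_mul_antideriv2 hh c (p := fun x => (1 - x) * cos (freq k * x))
    (p' := fun x => -cos (freq k * x) - freq k * ((1 - x) * sin (freq k * x)))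
    (p'' := fun x => 2 * freq k * sin (freq k * x) - freq k ^ 2 * ((1 - x) * cos (freq k * x)))
    (fun x => ((hs x).mul (hl x).cos).congr_deriv (by ring))
    (fun x => ((hl x).cos.neg.sub (((hs x).mul (hl x).sin).const_mul (freq k))).congr_deriv
      (by ring)) (by fun_prop)
    (by simp) (by simp [cos_freq])
  have e : ∀ x, (c + antideriv2 h x) *
      (2 * freq k * sin (freq k * x) - freq k ^ 2 * ((1 - x) * cos (freq k * x))) =
      2 * freq k * ((c + antideriv2 h x) * sin (freq k * x)) -
        freq k ^ 2 * ((c + antideriv2 h x) * (1 - x) * cos (freq k * x)) := fun x => by ring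
  simp_rw [e] at this
  rw [intervalIntegral.integral_sub ((by fun_prop : Continuous _).intervalIntegrable _ _)
    ((by fun_prop : Continuous _).intervalIntegrable _ _), intervalIntegral.integral_const_mul,
    intervalIntegral.integral_const_mul, hV] at this
  simp only [coef1, coef2, mul_assoc] at this ⊢
  linear_combination 4 * this

/-- A function whose coefficients satisfy the relations of the boundary value problem solves it. -/
theorem eqOn_antideriv2_of_coef {h : ℝ → ℝ} (hh : Continuous h) {f : ℝ → ℝ} (hf : ContinuousOn f (Icc 0 1)) (hfp : f 0 = f 1)
    (h0 : coef0 h = 0) (h2 : ∀ k, 1 ≤ k → coef2 h k = -freq k ^ 2 * coef2 f k)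
    (h1 : ∀ k, 1 ≤ k → coef1 h k = 2 * freq k * coef2 f k - freq k ^ 2 * coef1 f k) :
    EqOn f (fun x => f 0 + antideriv2 h x) (Icc 0 1) := by
  have hV : antideriv2 h 1 = 0 := by
    have := coef0_antideriv2 hh; rw [h0] at this; linarith
  have cV := continuous_antideriv2 hh
  have e2 : ∀ (c : ℝ) (k : ℕ), 1 ≤ k → coef2 f k = coef2 (fun x => c + antideriv2 h x) k := by
    intro c k hk
    have hne : freq k ^ 2 ≠ 0 := by have := freq_pos hk; positivity
    refine mul_left_cancel₀ hne ?_
    linear_combination h2 k hk - coef2_antideriv2 hh hV c k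
  -- The constant is chosen to match the coefficient at `1`; evaluation at `x = 0` later identifies
  -- it with `f 0`.
  have key : EqOn f (fun x => coef0 f - coef0 (antideriv2 h) + antideriv2 h x) (Icc 0 1) := by
    refine eqOn_of_coef_eq hf (by fun_prop) hfp (by simp only [antideriv2_zero h, hV]) ?_
      (fun k hk => ?_) (e2 _)
    · have hc : ∀ c, coef0 (fun _ => c) = c := fun c => by
        have := coef0_series (c := c) (A := fun _ => 0) (B := fun _ => 0) (by simp) (by simp)
        convert this using 2
        ext x; simp [series]
      have := coef0_sub (f := fun _ => coef0 f - coef0 (antideriv2 h))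
        (h := fun x => -antideriv2 h x) (by fun_prop) (by fun_prop)
      simp only [sub_neg_eq_add] at this
      rw [this, hc]
      simp [coef0, neg_mul]
    · have hne : freq k ^ 2 ≠ 0 := by have := freq_pos hk; positivity
      refine mul_left_cancel₀ hne ?_
      linear_combination h1 k hk - coef1_antideriv2 hh hV (coef0 f - coef0 (antideriv2 h)) k +
        2 * freq k * e2 (coef0 f - coef0 (antideriv2 h)) k hk
  have hf0 := key ⟨le_rfl, zero_le_one⟩
  simp only [antideriv2_zero h, add_zero] at hf0
  rw [hf0]
  exact key

/-- Classical solutions of `v'' = h` with `v' 0 = 0` are given by the second antiderivative. -/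
theorem eqOn_antideriv2_of_classical {h : ℝ → ℝ} (hh : Continuous h) {v : ℝ → ℝ} (hv : ContinuousOn v (Icc 0 1))
    (hC : ContDiffOn ℝ 2 v (Ioo 0 1)) (heq : ∀ x ∈ Ioo (0 : ℝ) 1, iteratedDeriv 2 v x = h x)
    (hN : HasDerivWithinAt v 0 (Icc 0 1) 0) :
    EqOn v (fun x => v 0 + antideriv2 h x) (Icc 0 1) := by
  have cV := continuous_antideriv2 hh
  have hd : ∀ x ∈ Ioo (0 : ℝ) 1, HasDerivAt v (deriv v x) x := fun x hx =>
    ((hC.contDiffAt (Ioo_mem_nhds hx.1 hx.2)).differentiableAt (by simp)).hasDerivAt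
  have hd2 : ∀ x ∈ Ioo (0 : ℝ) 1, HasDerivAt (deriv v) (h x) x := fun x hx => by
    have h1 : ContDiffAt ℝ 1 (deriv v) x :=
      (hC.deriv_of_isOpen isOpen_Ioo (by norm_num)).contDiffAt (Ioo_mem_nhds hx.1 hx.2)
    have := (h1.differentiableAt (by simp)).hasDerivAt
    have e := heq x hx
    rw [iteratedDeriv_succ, iteratedDeriv_one] at e
    rwa [e] at this
  have hφ : ∀ x ∈ Ioo (0 : ℝ) 1, HasDerivAt (fun x => v x - antideriv2 h x)
      (deriv v x - ∫ z in (0 : ℝ)..x, h z) x := fun x hx => (hd x hx).sub (hasDerivAt_antideriv2 hh x)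
  have hconst : ∀ x ∈ Ioo (0 : ℝ) 1, ∀ y ∈ Ioo (0 : ℝ) 1,
      (deriv v x - ∫ z in (0 : ℝ)..x, h z) = deriv v y - ∫ z in (0 : ℝ)..y, h z := by
    intro x hx y hy
    have hz : ∀ x ∈ Ioo (0 : ℝ) 1,
        HasDerivAt (fun x => deriv v x - ∫ z in (0 : ℝ)..x, h z) 0 x := fun x hx => by
      exact ((hd2 x hx).sub (hasDerivAt_primitive hh x)).congr_deriv (sub_self _)
    refine isOpen_Ioo.is_const_of_deriv_eq_zero isPreconnected_Ioo
      (fun x hx => (hz x hx).differentiableAt.differentiableWithinAt)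
      (fun x hx => (hz x hx).deriv) hx hy
  -- The derivative of `v - antideriv2 h` is constant on the open interval; `1 / 2` is an arbitrary
  -- sample point. The Neumann condition will show that this slope is zero.
  set c := deriv v (1 / 2) - ∫ z in (0 : ℝ)..(1 / 2), h z with hc
  have haff : ∀ x ∈ Icc (0 : ℝ) 1, v x - antideriv2 h x = v 0 + c * x := by
    intro x hx
    rcases hx.1.eq_or_lt with rfl | hpos
    · simp [antideriv2_zero h]
    obtain ⟨ξ, hξ, e⟩ := exists_hasDerivAt_eq_slope (fun x => v x - antideriv2 h x)
      (fun x => deriv v x - ∫ z in (0 : ℝ)..x, h z) hpos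
      ((hv.sub cV.continuousOn).mono (Icc_subset_Icc_right hx.2))
      (fun y hy => hφ y ⟨hy.1, hy.2.trans_le hx.2⟩)
    rw [hconst ξ ⟨hξ.1, hξ.2.trans_le hx.2⟩ (1 / 2) (by norm_num), ← hc, antideriv2_zero h,
      sub_zero, sub_zero, eq_div_iff hpos.ne'] at e
    linarith
  have hc0 : c = 0 := by
    have d1 : HasDerivWithinAt (fun x => v x - antideriv2 h x) (0 - 0) (Icc 0 1) 0 := by
      have := (hasDerivAt_antideriv2 hh 0).hasDerivWithinAt (s := Icc 0 1)
      rw [integral_same] at this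
      exact hN.sub this
    have d2 : HasDerivWithinAt (fun x => v x - antideriv2 h x) c (Icc 0 1) 0 := by
      have : HasDerivWithinAt (fun x => v 0 + c * x) c (Icc 0 1) 0 := by
        simpa using (((hasDerivAt_id (0 : ℝ)).const_mul c).const_add (v 0)).hasDerivWithinAt
      exact this.congr haff (haff 0 ⟨le_rfl, zero_le_one⟩)
    have := (uniqueDiffOn_Icc zero_lt_one 0 ⟨le_rfl, zero_le_one⟩).eq_deriv _ d1 d2
    linarith
  intro x hx
  have := haff x hx
  rw [hc0] at this
  show v x = v 0 + antideriv2 h x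
  linarith

/-! ### The coefficient functions in time -/

theorem den_eq (α : ℝ) (k : ℕ) : den α k = 1 + freq k ^ 2 * (1 - α) := rfl

theorem decay_eq (α : ℝ) (k : ℕ) (r : ℝ) :
    decay α k r = exp (-(α * freq k ^ 2 / den α k) * r) := by
  rw [decay]; congr 1; ring

theorem u0_eq_volt (α : ℝ) (g : ℝ → ℝ → ℝ) : u0 α g = volt α 0 (g0 g) := by
  ext t; simp [u0, volt, memory]

theorem u2_eq_volt (α : ℝ) (g : ℝ → ℝ → ℝ) (k : ℕ) :
    u2 α g k = volt α (freq k ^ 2) (g2 g k) := by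
  ext t; simp only [u2, volt, memory, decay_eq, den_eq]

/-- Convolving the exponential kernel with itself gives `r * exp (-a r)`. The proof integrates by
parts with the factor `t - z`. -/
theorem memory_memory {f : ℝ → ℝ} (hf : Continuous f) (a t : ℝ) :
    memory a (memory a f) t = ∫ z in (0 : ℝ)..t, f z * (t - z) * exp (-a * (t - z)) := by
  have hp : Continuous fun z => f z * exp (a * z) := by fun_prop
  have hP := continuous_primitive hp
  have e1 : ∀ s, memory a f s * exp (a * s) = ∫ z in (0 : ℝ)..s, f z * exp (a * z) := fun s => by
    have : exp (-a * s) * exp (a * s) = 1 := by rw [← exp_add]; simp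
    rw [memory_eq]
    linear_combination (∫ z in (0 : ℝ)..s, f z * exp (a * z)) * this
  have key := integral_eq_sub_of_hasDerivAt (a := 0) (b := t)
    (f := fun z => (t - z) * ∫ r in (0 : ℝ)..z, f r * exp (a * r))
    (f' := fun z => (t - z) * (f z * exp (a * z)) - ∫ r in (0 : ℝ)..z, f r * exp (a * r))
    (fun z _ => (((hasDerivAt_id z).const_sub t).mul (hasDerivAt_primitive hp z)).congr_deriv
      (by simp; ring)) ((by fun_prop : Continuous _).intervalIntegrable _ _)
  rw [intervalIntegral.integral_sub ((by fun_prop : Continuous _).intervalIntegrable _ _)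
    (hP.intervalIntegrable _ _)] at key
  simp only [sub_self, zero_mul, integral_same, mul_zero] at key
  rw [memory_eq]
  simp_rw [e1]
  rw [← sub_eq_zero.1 key, ← intervalIntegral.integral_const_mul]
  congr 1; ext z
  rw [show -a * (t - z) = -a * t + a * z by ring, exp_add]; ring

theorem memory_linear {f h : ℝ → ℝ} (hf : Continuous f) (hh : Continuous h) (a c t : ℝ) :
    memory a (fun s => f s + c * h s) t = memory a f t + c * memory a h t := by
  simp only [memory]
  rw [← intervalIntegral.integral_const_mul, ← intervalIntegral.integral_add
    ((by fun_prop : Continuous _).intervalIntegrable _ _)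
    ((by fun_prop : Continuous _).intervalIntegrable _ _)]
  congr 1; ext s; ring

section Continuous

variable {G : ℝ → ℝ → ℝ}

theorem continuous_integral_mul (hG : Continuous (Function.uncurry G)) {φ : ℝ → ℝ}
    (hφ : Continuous φ) : Continuous fun t => ∫ x in (0 : ℝ)..1, G x t * φ x := by
  refine continuous_parametric_intervalIntegral_of_continuous' ?_ 0 1
  have : Continuous fun p : ℝ × ℝ => G p.2 p.1 := hG.comp continuous_swap
  exact this.mul (hφ.comp continuous_snd)

theorem continuous_g0 (hG : Continuous (Function.uncurry G)) : Continuous (g0 G) :=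
  (continuous_integral_mul hG (by fun_prop)).const_mul 2

theorem continuous_g1 (hG : Continuous (Function.uncurry G)) (k : ℕ) : Continuous (g1 G k) := by
  unfold g1
  simp_rw [mul_assoc]
  exact (continuous_integral_mul hG (φ := fun x => (1 - x) * cos (freq k * x))
    (by fun_prop)).const_mul 4

theorem continuous_g2 (hG : Continuous (Function.uncurry G)) (k : ℕ) : Continuous (g2 G k) :=
  (continuous_integral_mul hG (by fun_prop)).const_mul 4

theorem continuous_u0 (hG : Continuous (Function.uncurry G)) (α : ℝ) : Continuous (u0 α G) := by
  rw [u0_eq_volt]; exact continuous_volt (continuous_g0 hG) _ _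

theorem continuous_u2 (hG : Continuous (Function.uncurry G)) (α : ℝ) (k : ℕ) :
    Continuous (u2 α G k) := by
  rw [u2_eq_volt]; exact continuous_volt (continuous_g2 hG k) _ _

theorem continuous_rhs (hG : Continuous (Function.uncurry G)) (α : ℝ) (k : ℕ) :
    Continuous fun t => g1 G k t + 4 * k * π * u2 α G k t := by
  have := continuous_g1 hG k
  have := continuous_u2 hG α k
  fun_prop

/-- Inserting `u2` into the source makes the memory of `g2` appear twice, whence `8 k π` from two
copies of `4 k π`, and the double memory gives the factor `t - z`. -/
theorem u1_eq_volt (hG : Continuous (Function.uncurry G)) (α : ℝ) (k : ℕ) :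
    u1 α G k = volt α (freq k ^ 2) fun t => g1 G k t + 4 * k * π * u2 α G k t := by
  have c1 := continuous_g1 hG k
  have c2 := continuous_g2 hG k
  ext t
  set l := α * freq k ^ 2 / den α k with hl
  have e1 : ∫ z in (0 : ℝ)..t, decay α k (t - z) *
      (g1 G k z + 8 * k * π * (1 - α) / den α k * g2 G k z +
        4 * k * π * α / den α k ^ 2 * g2 G k z * (t - z)) =
      memory l (g1 G k) t + 8 * k * π * (1 - α) / den α k * memory l (g2 G k) t +
        4 * k * π * α / den α k ^ 2 * memory l (memory l (g2 G k)) t := by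
    rw [← memory_linear c1 c2, memory_memory c2, memory, ← intervalIntegral.integral_const_mul,
      ← intervalIntegral.integral_add ((by fun_prop : Continuous _).intervalIntegrable _ _)
        ((by fun_prop : Continuous _).intervalIntegrable _ _)]
    congr 1; ext z; rw [decay_eq, ← hl]; ring
  have hv : u2 α G k = fun s => (1 - α) / den α k * g2 G k s +
      α / den α k ^ 2 * memory l (g2 G k) s := u2_eq_volt α G k
  have e2 : memory l (u2 α G k) t = (1 - α) / den α k * memory l (g2 G k) t +
      α / den α k ^ 2 * memory l (memory l (g2 G k)) t := by
    have := memory_linear (a := l) (t := t) (c := α / den α k ^ 2)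
      (c2.const_mul ((1 - α) / den α k)) (continuous_memory c2 l)
    rw [hv, this]
    congr 1
    simp only [memory, ← intervalIntegral.integral_const_mul]
    congr 1; ext s; ring
  rw [u1, e1, volt, memory_linear c1 (continuous_u2 hG α k), ← den_eq, ← hl, e2, hv]
  ring

theorem continuous_u1 (hG : Continuous (Function.uncurry G)) (α : ℝ) (k : ℕ) :
    Continuous (u1 α G k) := by
  rw [u1_eq_volt hG]; exact continuous_volt (continuous_rhs hG α k) _ _

/-- Integration in space commutes with the memory term. -/
theorem integral_memory_mul (hG : Continuous (Function.uncurry G)) {φ : ℝ → ℝ} (hφ : Continuous φ)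
    (a t : ℝ) :
    ∫ x in (0 : ℝ)..1, memory a (G x) t * φ x =
      memory a (fun s => ∫ x in (0 : ℝ)..1, G x s * φ x) t := by
  simp only [memory, ← intervalIntegral.integral_mul_const]
  rw [intervalIntegral_intervalIntegral_swap]
  · congr 1; ext s; congr 1; ext x; ring
  · have : Continuous (Function.uncurry fun x s => G x s * exp (-a * (t - s)) * φ x) := by
      have h1 : Continuous fun p : ℝ × ℝ => G p.1 p.2 := hG
      simp only [Function.uncurry_def]
      fun_prop
    exact (this.continuousOn.integrableOn_compact (isCompact_uIcc.prod isCompact_uIcc)).mono_set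
      (prod_mono uIoc_subset_uIcc uIoc_subset_uIcc)

theorem memory_const_mul (a c t : ℝ) (f : ℝ → ℝ) :
    memory a (fun s => c * f s) t = c * memory a f t := by
  simp only [memory, ← intervalIntegral.integral_const_mul]
  congr 1; ext s; ring

theorem continuous_memory_space (hG : Continuous (Function.uncurry G)) (a t : ℝ) :
    Continuous fun x => memory a (G x) t := by
  refine continuous_parametric_intervalIntegral_of_continuous' ?_ 0 t
  have h1 : Continuous fun p : ℝ × ℝ => G p.1 p.2 := hG
  simp only [Function.uncurry_def]
  fun_prop

end Continuous

/-! ### The elliptic right-hand side -/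

/-- The function `D_t^α u - g`, with the fractional derivative integrated by parts. -/
def rhs (α : ℝ) (g u : ℝ → ℝ → ℝ) (t x : ℝ) : ℝ :=
  (u x t - α / (1 - α) * memory (α / (1 - α)) (u x) t) / (1 - α) - g x t

section Rhs

variable {G U : ℝ → ℝ → ℝ}

theorem continuous_rhs_space (hG : Continuous (Function.uncurry G))
    (hU : Continuous (Function.uncurry U)) (α t : ℝ) : Continuous (rhs α G U t) := by
  have h1 := continuous_memory_space hU (α / (1 - α)) t
  have h2 : Continuous fun x => U x t := hU.comp (by fun_prop : Continuous fun x : ℝ => (x, t))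
  have h3 : Continuous fun x => G x t := hG.comp (by fun_prop : Continuous fun x : ℝ => (x, t))
  unfold rhs
  fun_prop

theorem integral_rhs_mul (hG : Continuous (Function.uncurry G))
    (hU : Continuous (Function.uncurry U)) (α t : ℝ) {φ : ℝ → ℝ} (hφ : Continuous φ) (c : ℝ) :
    c * ∫ x in (0 : ℝ)..1, rhs α G U t x * φ x =
      (c * (∫ x in (0 : ℝ)..1, U x t * φ x) - α / (1 - α) *
        memory (α / (1 - α)) (fun s => c * ∫ x in (0 : ℝ)..1, U x s * φ x) t) / (1 - α) -
        c * ∫ x in (0 : ℝ)..1, G x t * φ x := by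
  have h1 := continuous_memory_space hU (α / (1 - α)) t
  have h2 : Continuous fun x => U x t := hU.comp (by fun_prop : Continuous fun x : ℝ => (x, t))
  have h3 : Continuous fun x => G x t := hG.comp (by fun_prop : Continuous fun x : ℝ => (x, t))
  have e : ∀ x, rhs α G U t x * φ x = (1 / (1 - α)) * (U x t * φ x) -
      (α / (1 - α) / (1 - α)) * (memory (α / (1 - α)) (U x) t * φ x) - G x t * φ x := by
    intro x; unfold rhs; ring
  simp_rw [e]
  rw [intervalIntegral.integral_sub ((by fun_prop : Continuous _).intervalIntegrable _ _)
    ((by fun_prop : Continuous _).intervalIntegrable _ _),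
    intervalIntegral.integral_sub ((by fun_prop : Continuous _).intervalIntegrable _ _)
    ((by fun_prop : Continuous _).intervalIntegrable _ _), intervalIntegral.integral_const_mul,
    intervalIntegral.integral_const_mul, integral_memory_mul hU hφ, memory_const_mul]
  ring

theorem coef0_rhs (hG : Continuous (Function.uncurry G)) (hU : Continuous (Function.uncurry U))
    (α t : ℝ) : coef0 (rhs α G U t) =
      (g0 U t - α / (1 - α) * memory (α / (1 - α)) (g0 U) t) / (1 - α) - g0 G t :=
  integral_rhs_mul hG hU α t (by fun_prop) 2

theorem coef1_rhs (hG : Continuous (Function.uncurry G)) (hU : Continuous (Function.uncurry U))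
    (α t : ℝ) (k : ℕ) : coef1 (rhs α G U t) k =
      (g1 U k t - α / (1 - α) * memory (α / (1 - α)) (g1 U k) t) / (1 - α) - g1 G k t := by
  have := integral_rhs_mul hG hU α t (φ := fun x => (1 - x) * cos (freq k * x)) (by fun_prop) 4
  simp only [← mul_assoc] at this
  exact this

theorem coef2_rhs (hG : Continuous (Function.uncurry G)) (hU : Continuous (Function.uncurry U))
    (α t : ℝ) (k : ℕ) : coef2 (rhs α G U t) k =
      (g2 U k t - α / (1 - α) * memory (α / (1 - α)) (g2 U k) t) / (1 - α) - g2 G k t :=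
  integral_rhs_mul hG hU α t (by fun_prop) 4

end Rhs

/-! ### Bounds for the coefficient functions -/

theorem abs_integral_mul_le {f φ : ℝ → ℝ} (hf : ContinuousOn f (Icc 0 1))
    (hφ : ∀ x ∈ Icc (0 : ℝ) 1, |φ x| ≤ 1) :
    |∫ x in (0 : ℝ)..1, f x * φ x| ≤ ∫ x in (0 : ℝ)..1, |f x| := by
  rw [← norm_eq_abs]
  refine norm_integral_le_of_norm_le zero_le_one (.of_forall fun x hx => ?_)
    (ContinuousOn.intervalIntegrable (by rw [uIcc_of_le zero_le_one]; exact hf.abs))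
  rw [norm_mul]
  exact mul_le_of_le_one_right (norm_nonneg _) (hφ x (Ioc_subset_Icc_self hx))

theorem abs_one_sub_le {x : ℝ} (hx : x ∈ Icc (0 : ℝ) 1) : |1 - x| ≤ 1 :=
  abs_le.2 ⟨by linarith [hx.2], by linarith [hx.1]⟩

theorem abs_coef_le {f : ℝ → ℝ} (hf : ContinuousOn f (Icc 0 1)) :
    |coef0 f| ≤ 4 * (∫ x in (0 : ℝ)..1, |f x|) ∧
      ∀ k, |coef1 f k| ≤ 4 * (∫ x in (0 : ℝ)..1, |f x|) ∧
        |coef2 f k| ≤ 4 * ∫ x in (0 : ℝ)..1, |f x| := by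
  have hnn : 0 ≤ ∫ x in (0 : ℝ)..1, |f x| :=
    intervalIntegral.integral_nonneg zero_le_one fun x _ => abs_nonneg _
  refine ⟨?_, fun k => ⟨?_, ?_⟩⟩
  · rw [coef0, abs_mul, abs_two]
    have := abs_integral_mul_le hf (fun x hx => abs_one_sub_le hx)
    linarith
  · rw [coef1, abs_mul, abs_of_pos (by norm_num : (0 : ℝ) < 4)]
    simp_rw [mul_assoc]
    refine mul_le_mul_of_nonneg_left (abs_integral_mul_le hf fun x hx => ?_) (by norm_num)
    rw [abs_mul]
    exact mul_le_one₀ (abs_one_sub_le hx) (abs_nonneg _) (abs_cos_le_one _)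
  · rw [coef2, abs_mul, abs_of_pos (by norm_num : (0 : ℝ) < 4)]
    exact mul_le_mul_of_nonneg_left (abs_integral_mul_le hf fun x _ => abs_sin_le_one _)
      (by norm_num)

theorem one_div_den_le {α : ℝ} (hα1 : α < 1) (k : ℕ) :
    1 / den α (k + 1) ≤ 1 / (1 - α) * (1 / ((k : ℝ) + 1) ^ 2) := by
  have h1 : 0 < 1 - α := by linarith
  rw [div_mul_div_comm, one_mul]
  refine one_div_le_one_div_of_le (by positivity) ?_
  have h2 : ((k : ℝ) + 1) ^ 2 ≤ freq (k + 1) ^ 2 := by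
    refine pow_le_pow_left₀ (by positivity) ?_ 2
    unfold freq
    push_cast
    nlinarith [pi_gt_three, (Nat.cast_nonneg k : (0 : ℝ) ≤ k)]
  rw [den_eq]
  nlinarith

theorem summable_one_div_den {α : ℝ} (hα1 : α < 1) : Summable fun k => 1 / den α (k + 1) := by
  have h1 : Summable fun k : ℕ => 1 / ((k : ℝ) + 1) ^ 2 := by
    have := (summable_nat_add_iff 1).2 (Real.summable_one_div_nat_pow.2 one_lt_two)
    simpa using this
  refine Summable.of_nonneg_of_le (fun k => ?_) (one_div_den_le hα1)
    (h1.mul_left (1 / (1 - α)))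
  have := den_pos hα1 (sq_nonneg (freq (k + 1)))
  rw [den_eq]; positivity

/-- From `2 ω ≤ 1 + ω²`: the growth of the coupling factor is absorbed by the decay of `u2`,
uniformly in `k`. -/
theorem two_mul_freq_div_den_le {α : ℝ} (hα1 : α < 1) (k : ℕ) :
    2 * freq k / den α k ≤ 1 + 1 / (1 - α) := by
  have h1 : 0 < 1 - α := by linarith
  have hq := den_pos hα1 (sq_nonneg (freq k))
  rw [den_eq, div_le_iff₀ (by linarith)]
  have : (1 + 1 / (1 - α)) * (1 + freq k ^ 2 * (1 - α)) =
      (1 + freq k ^ 2 * (1 - α)) + 1 / (1 - α) + freq k ^ 2 := by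
    field_simp
    ring
  rw [this]
  have : 0 < 1 / (1 - α) := by positivity
  nlinarith [sq_nonneg (freq k - 1)]

section Bounds

variable {G : ℝ → ℝ → ℝ} {α T M : ℝ} {F : ℝ → ℝ}

/-- Uniform bounds on the coefficients of the solution and on their increments. -/
theorem exists_coefficient_bounds (hα : 0 < α) (hα1 : α < 1) (hT : 0 < T)
    (hG : Continuous (Function.uncurry G))
    (hM : ∀ x ∈ Icc (0 : ℝ) 1, ∀ t ∈ Icc 0 T, |G x t| ≤ M)
    (hF : AbsolutelyContinuousOnInterval F 0 T)
    (hGF : ∀ s ∈ Icc 0 T, ∀ t ∈ Icc 0 T, s ≤ t →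
      ∫ x in (0 : ℝ)..1, |G x t - G x s| ≤ F t - F s) :
    ∃ (C : ℝ) (H : ℝ → ℝ), AbsolutelyContinuousOnInterval H 0 T ∧
      (∀ k, ∀ t ∈ Icc 0 T, |u1 α G k t| ≤ C / den α k ∧ |u2 α G k t| ≤ C / den α k) ∧
      ∀ s ∈ Icc 0 T, ∀ t ∈ Icc 0 T, s ≤ t → |u0 α G t - u0 α G s| ≤ H t - H s ∧
        ∀ k, |u1 α G k t - u1 α G k s| ≤ (H t - H s) / den α k ∧
          |u2 α G k t - u2 α G k s| ≤ (H t - H s) / den α k := by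
  have hM0 : 0 ≤ M := (abs_nonneg _).trans
    (hM 0 ⟨le_rfl, zero_le_one⟩ 0 ⟨le_rfl, hT.le⟩)
  have hGc : ∀ t, Continuous fun x => G x t := fun t =>
    hG.comp (by fun_prop : Continuous fun x : ℝ => (x, t))
  have hint : ∀ t ∈ Icc 0 T, ∫ x in (0 : ℝ)..1, |G x t| ≤ M := fun t ht => by
    have := intervalIntegral.integral_mono_on zero_le_one
      ((hGc t).abs.intervalIntegrable (μ := volume) 0 1)
      ((continuous_const (y := M)).intervalIntegrable (μ := volume) 0 1)
      (fun x hx => hM x hx t ht)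
    simpa using this
  have b0 : ∀ t ∈ Icc 0 T, |g0 G t| ≤ 4 * M := fun t ht =>
    (abs_coef_le (hGc t).continuousOn).1.trans (by linarith [hint t ht])
  have b1 : ∀ k, ∀ t ∈ Icc 0 T, |g1 G k t| ≤ 4 * M := fun k t ht =>
    ((abs_coef_le (hGc t).continuousOn).2 k).1.trans (by linarith [hint t ht])
  have b2 : ∀ k, ∀ t ∈ Icc 0 T, |g2 G k t| ≤ 4 * M := fun k t ht =>
    ((abs_coef_le (hGc t).continuousOn).2 k).2.trans (by linarith [hint t ht])
  have d0 : ∀ s ∈ Icc 0 T, ∀ t ∈ Icc 0 T, s ≤ t → |g0 G t - g0 G s| ≤ 4 * (F t - F s) :=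
    fun s hs t ht hst => by
      have := (abs_coef_le (f := fun x => G x t - G x s) ((hGc t).sub (hGc s)).continuousOn).1
      rw [coef0_sub (hGc t).continuousOn (hGc s).continuousOn] at this
      exact this.trans (by linarith [hGF s hs t ht hst])
  have d1 : ∀ k, ∀ s ∈ Icc 0 T, ∀ t ∈ Icc 0 T, s ≤ t → |g1 G k t - g1 G k s| ≤ 4 * (F t - F s) :=
    fun k s hs t ht hst => by
      have := ((abs_coef_le (f := fun x => G x t - G x s) ((hGc t).sub (hGc s)).continuousOn).2 k).1
      rw [coef1_sub (hGc t).continuousOn (hGc s).continuousOn] at this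
      exact this.trans (by linarith [hGF s hs t ht hst])
  have d2 : ∀ k, ∀ s ∈ Icc 0 T, ∀ t ∈ Icc 0 T, s ≤ t → |g2 G k t - g2 G k s| ≤ 4 * (F t - F s) :=
    fun k s hs t ht hst => by
      have := ((abs_coef_le (f := fun x => G x t - G x s) ((hGc t).sub (hGc s)).continuousOn).2 k).2
      rw [coef2_sub (hGc t).continuousOn (hGc s).continuousOn] at this
      exact this.trans (by linarith [hGF s hs t ht hst])
  have hF0 : ∀ s ∈ Icc 0 T, ∀ t ∈ Icc 0 T, s ≤ t → 0 ≤ F t - F s := fun s hs t ht hst =>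
    (intervalIntegral.integral_nonneg zero_le_one fun x _ => abs_nonneg _).trans
      (hGF s hs t ht hst)
  have h1 : 0 < 1 - α := by linarith
  set K := 1 + 1 / (1 - α) with hK
  have hK1 : 1 ≤ K := by have : 0 < 1 / (1 - α) := by positivity
                         linarith
  set L := α / (1 - α) * (1 + α / (1 - α) * T) * (1 + T) with hL
  have hL0 : 0 ≤ L := by positivity
  have hq : ∀ k, 1 ≤ den α k := fun k => den_pos hα1 (sq_nonneg _)
  -- `R` bounds every source uniformly in `k`: `4 * M` for the coefficients of `G`, plus the
  -- coupling contribution controlled by `K`.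
  set R := 4 * M + K * (4 * M * (1 + T)) with hR
  have hKM : 0 ≤ K * (4 * M * (1 + T)) := by positivity
  have hMR : 4 * M ≤ R := by linarith
  have hR0 : 0 ≤ R := by linarith
  have hfk : ∀ k : ℕ, 4 * k * π = 2 * freq k := fun k => by unfold freq; ring
  have hfk0 : ∀ k : ℕ, 0 ≤ freq k := fun k => by unfold freq; positivity
  have bu2 : ∀ k, ∀ t ∈ Icc 0 T, |u2 α G k t| ≤ 4 * M * (1 + T) / den α k := fun k t ht => by
    rw [u2_eq_volt]
    exact abs_volt_le hα hα1 (sq_nonneg _) (b2 k) ht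
  have du2 : ∀ k, ∀ s ∈ Icc 0 T, ∀ t ∈ Icc 0 T, s ≤ t → |u2 α G k t - u2 α G k s| ≤
      (4 * (F t - F s) + L * R * (t - s)) / den α k := fun k s hs t ht hst => by
    rw [u2_eq_volt]
    refine (abs_volt_sub_le hα hα1 (sq_nonneg _) (continuous_g2 hG k) (b2 k) hs ht hst).trans ?_
    rw [← den_eq, ← hL]
    have := hq k
    have : 0 ≤ t - s := sub_nonneg.2 hst
    have := d2 k s hs t ht hst
    gcongr
  have bf : ∀ k, ∀ t ∈ Icc 0 T, |g1 G k t + 4 * k * π * u2 α G k t| ≤ R := fun k t ht => by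
    refine (abs_add_le _ _).trans (add_le_add (b1 k t ht) ?_)
    rw [abs_mul, hfk, abs_of_nonneg (by have := hfk0 k; positivity)]
    calc 2 * freq k * |u2 α G k t| ≤ 2 * freq k * (4 * M * (1 + T) / den α k) := by
          have := hfk0 k
          have := bu2 k t ht
          gcongr
      _ = 2 * freq k / den α k * (4 * M * (1 + T)) := by ring
      _ ≤ K * (4 * M * (1 + T)) := by
          have := two_mul_freq_div_den_le hα1 k
          gcongr
  have df : ∀ k, ∀ s ∈ Icc 0 T, ∀ t ∈ Icc 0 T, s ≤ t →
      |(g1 G k t + 4 * k * π * u2 α G k t) - (g1 G k s + 4 * k * π * u2 α G k s)| ≤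
        4 * (F t - F s) + K * (4 * (F t - F s) + L * R * (t - s)) := fun k s hs t ht hst => by
    have ht0 : 0 ≤ t - s := sub_nonneg.2 hst
    have hF0' := hF0 s hs t ht hst
    rw [show (g1 G k t + 4 * k * π * u2 α G k t) - (g1 G k s + 4 * k * π * u2 α G k s) =
      (g1 G k t - g1 G k s) + 4 * k * π * (u2 α G k t - u2 α G k s) by ring]
    refine (abs_add_le _ _).trans (add_le_add (d1 k s hs t ht hst) ?_)
    rw [abs_mul, hfk, abs_of_nonneg (by have := hfk0 k; positivity)]
    calc 2 * freq k * |u2 α G k t - u2 α G k s|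
        ≤ 2 * freq k * ((4 * (F t - F s) + L * R * (t - s)) / den α k) := by
          have := hfk0 k
          have := du2 k s hs t ht hst
          gcongr
      _ = 2 * freq k / den α k * (4 * (F t - F s) + L * R * (t - s)) := by ring
      _ ≤ _ := by
          have := two_mul_freq_div_den_le hα1 k
          gcongr
  -- `H` adds the dominating function of the coupled source to the Lipschitz term `L * R * t` from
  -- `abs_volt_sub_le`.
  refine ⟨R * (1 + T), fun t => (4 + 4 * K) * F t + (L * R + K * (L * R)) * t, ?_,
    fun k t ht => ⟨?_, ?_⟩, fun s hs t ht hst => ?_⟩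
  · exact (hF.const_mul _).fun_add (ContDiffOn.absolutelyContinuousOnInterval (by fun_prop))
  · rw [u1_eq_volt hG]
    exact abs_volt_le hα hα1 (sq_nonneg _) (bf k) ht
  · refine (bu2 k t ht).trans ?_
    have := hq k
    gcongr
  · have ht0 : 0 ≤ t - s := sub_nonneg.2 hst
    have hF0' := hF0 s hs t ht hst
    have hLR : 0 ≤ L * R * (t - s) := by positivity
    have hKF : 0 ≤ K * (F t - F s) := by positivity
    have hKLR : 0 ≤ K * (L * R * (t - s)) := by positivity
    refine ⟨?_, fun k => ⟨?_, ?_⟩⟩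
    · rw [u0_eq_volt]
      refine (abs_volt_sub_le hα hα1 le_rfl (continuous_g0 hG) b0 hs ht hst).trans ?_
      rw [zero_mul, add_zero, div_one, ← hL]
      have h2 : L * (4 * M) * (t - s) ≤ L * R * (t - s) := by gcongr
      linarith [d0 s hs t ht hst]
    · rw [u1_eq_volt hG]
      refine (abs_volt_sub_le hα hα1 (sq_nonneg _) (continuous_rhs hG α k) (bf k)
        hs ht hst).trans ?_
      rw [← den_eq, ← hL]
      have := hq k
      refine div_le_div_of_nonneg_right ?_ (by linarith)
      linarith [df k s hs t ht hst]
    · refine (du2 k s hs t ht hst).trans ?_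
      have := hq k
      refine div_le_div_of_nonneg_right ?_ (by linarith)
      linarith

end Bounds

/-! ### Increments of the source in time -/

/-- Take `F` to be the time primitive of the spatial integral of `|g_t|`: apply the fundamental
theorem of calculus for almost every `x`, then Fubini. -/
theorem exists_increment_bound {T : ℝ} (hT : 0 < T) {g : ℝ → ℝ → ℝ}
    (hg : ContinuousOn (fun p : ℝ × ℝ => g p.1 p.2) (Icc 0 1 ×ˢ Icc 0 T))
    (hgt_ac : ∀ᵐ x ∂(volume.restrict (Icc (0 : ℝ) 1)), AbsolutelyContinuousOnInterval (g x) 0 T)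
    (hgt : IntegrableOn (fun p : ℝ × ℝ => deriv (g p.1) p.2) (Ioo 0 1 ×ˢ Ioo 0 T)) :
    ∃ F : ℝ → ℝ, AbsolutelyContinuousOnInterval F 0 T ∧
      ∀ s ∈ Icc 0 T, ∀ t ∈ Icc 0 T, s ≤ t →
        ∫ x in (0 : ℝ)..1, |g x t - g x s| ≤ F t - F s := by
  set m : ℝ → ℝ := fun r => ∫ x in Ioo (0 : ℝ) 1, |deriv (g x) r| with hm
  have hprod : ∀ S ⊆ Ioo 0 T, Integrable (fun p : ℝ × ℝ => |deriv (g p.1) p.2|)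
      ((volume.restrict (Ioo (0 : ℝ) 1)).prod (volume.restrict S)) := fun S hS => by
    rw [Measure.prod_restrict, ← Measure.volume_eq_prod]
    exact (hgt.mono_set (prod_mono_right hS)).norm
  have hmi : IntervalIntegrable m volume 0 T := by
    rw [intervalIntegrable_iff_integrableOn_Ioo_of_le hT.le]
    exact (hprod _ subset_rfl).integral_prod_right
  refine ⟨fun t => ∫ r in (0 : ℝ)..t, m r,
    hmi.absolutelyContinuousOnInterval_intervalIntegral left_mem_uIcc, fun s hs t ht hst => ?_⟩
  have hsub : ∀ a ∈ Icc 0 T, ∀ b ∈ Icc 0 T, IntervalIntegrable m volume a b :=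
    fun a ha b hb => hmi.mono_set (by
      rw [uIcc_of_le hT.le]; exact uIcc_subset_Icc ha hb)
  have h0 : (0 : ℝ) ∈ Icc 0 T := ⟨le_rfl, hT.le⟩
  show _ ≤ (∫ r in (0 : ℝ)..t, m r) - ∫ r in (0 : ℝ)..s, m r
  rw [integral_interval_sub_left (hsub 0 h0 t ht) (hsub 0 h0 s hs)]
  have hSub : Ioo s t ⊆ Ioo 0 T := Ioo_subset_Ioo hs.1 ht.2
  have hP := hprod _ hSub
  rw [integral_of_le hst, integral_of_le zero_le_one, integral_Ioc_eq_integral_Ioo,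
    integral_Ioc_eq_integral_Ioo, hm, ← integral_integral_swap (f := fun x r => |deriv (g x) r|) hP]
  have hcont : ∀ t ∈ Icc 0 T, ContinuousOn (fun x => g x t) (Icc 0 1) := fun t ht =>
    hg.comp (f := fun x : ℝ => (x, t)) (by fun_prop) (fun x hx => ⟨hx, ht⟩)
  refine integral_mono_ae ?_ hP.integral_prod_left ?_
  · exact ((hcont t ht).sub (hcont s hs)).abs.integrableOn_Icc.mono_set Ioo_subset_Icc_self
  · filter_upwards [ae_restrict_of_ae_restrict_of_subset Ioo_subset_Icc_self hgt_ac] with x hx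
    rw [← (absolutelyContinuous_mono hs ht hx).integral_deriv_eq_sub,
      ← integral_Ioc_eq_integral_Ioo, ← integral_of_le hst]
    exact abs_integral_le_integral_abs hst

/-! ### The series solution -/

/-- The sum of the series of root functions with the coefficients `u0`, `u1`, `u2`. -/
def seriesSolution (α : ℝ) (g : ℝ → ℝ → ℝ) (x t : ℝ) : ℝ :=
  series (u0 α g t) (fun k => u1 α g (k + 1) t) (fun k => u2 α g (k + 1) t) x

theorem summable_abs_of_le_div_den {α C : ℝ} (hα1 : α < 1) {A : ℕ → ℝ}
    (h : ∀ k, |A k| ≤ C / den α (k + 1)) : Summable fun k => |A k| :=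
  Summable.of_nonneg_of_le (fun k => abs_nonneg _) h (by
    simpa [div_eq_mul_inv] using (summable_one_div_den hα1).mul_left C)

theorem series_zero_eq_one (c : ℝ) (A B : ℕ → ℝ) : series c A B 0 = series c A B 1 := by
  simp [series, cos_freq, sin_freq]

theorem continuous_series {c : ℝ} {A B : ℕ → ℝ} (hA : Summable fun k => |A k|)
    (hB : Summable fun k => |B k|) : ContinuousOn (series c A B) (Icc 0 1) := by
  have c1 : ContinuousOn (fun x => ∑' k, A k * cos (freq (k + 1) * x)) (Icc 0 1) :=
    continuousOn_tsum (fun k => by fun_prop) hA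
      (fun k x _ => (norm_eq_abs _).trans_le (abs_mul_cos_le (A k) (freq (k + 1) * x)))
  have c2 : ContinuousOn (fun x => ∑' k, B k * (x * sin (freq (k + 1) * x))) (Icc 0 1) :=
    continuousOn_tsum (fun k => by fun_prop) hB (fun k x hx => (norm_eq_abs _).trans_le
      (abs_mul_mul_sin_le (B k) (freq (k + 1) * x) hx))
  exact (continuousOn_const.add c1).add c2

theorem summable_mul_cos {A : ℕ → ℝ} (hA : Summable fun k => |A k|) (x : ℝ) :
    Summable fun k => A k * cos (freq (k + 1) * x) :=
  Summable.of_norm_bounded hA fun k =>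
    (norm_eq_abs _).trans_le (abs_mul_cos_le (A k) (freq (k + 1) * x))

theorem summable_mul_mul_sin {B : ℕ → ℝ} (hB : Summable fun k => |B k|) {x : ℝ}
    (hx : x ∈ Icc (0 : ℝ) 1) : Summable fun k => B k * (x * sin (freq (k + 1) * x)) :=
  Summable.of_norm_bounded hB fun k =>
    (norm_eq_abs _).trans_le (abs_mul_mul_sin_le (B k) (freq (k + 1) * x) hx)

theorem abs_series_sub_le {c c' : ℝ} {A B A' B' : ℕ → ℝ} (hA : Summable fun k => |A k|)
    (hB : Summable fun k => |B k|) (hA' : Summable fun k => |A' k|)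
    (hB' : Summable fun k => |B' k|) {r : ℕ → ℝ} (hr : Summable r)
    (h1 : ∀ k, |A k - A' k| ≤ r k) (h2 : ∀ k, |B k - B' k| ≤ r k) {x : ℝ}
    (hx : x ∈ Icc (0 : ℝ) 1) :
    |series c A B x - series c' A' B' x| ≤ |c - c'| + 2 * ∑' k, r k := by
  have e1 := tsum_of_norm_bounded (f := fun k => (A k - A' k) * cos (freq (k + 1) * x)) hr.hasSum
    (fun k => (norm_eq_abs _).trans_le ((abs_mul_cos_le (A k - A' k) _).trans (h1 k)))
  have e2 := tsum_of_norm_bounded (f := fun k => (B k - B' k) * (x * sin (freq (k + 1) * x)))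
    hr.hasSum (fun k => (norm_eq_abs _).trans_le
      ((abs_mul_mul_sin_le (B k - B' k) _ hx).trans (h2 k)))
  simp only [sub_mul] at e1 e2
  rw [(summable_mul_cos hA x).tsum_sub (summable_mul_cos hA' x), norm_eq_abs] at e1
  rw [(summable_mul_mul_sin hB hx).tsum_sub (summable_mul_mul_sin hB' hx), norm_eq_abs] at e2
  have : series c A B x - series c' A' B' x = (c - c') +
      ((∑' k, A k * cos (freq (k + 1) * x)) - ∑' k, A' k * cos (freq (k + 1) * x)) +
      ((∑' k, B k * (x * sin (freq (k + 1) * x))) - ∑' k, B' k * (x * sin (freq (k + 1) * x))) := by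
    unfold series; ring
  rw [this]
  refine (abs_add_three _ _ _).trans ?_
  linarith

/-- A continuous function on the rectangle extends continuously to the plane. -/
theorem exists_continuous_extension {T : ℝ} (hT : 0 ≤ T) {g : ℝ → ℝ → ℝ}
    (hg : ContinuousOn (fun p : ℝ × ℝ => g p.1 p.2) (Icc 0 1 ×ˢ Icc 0 T)) :
    ∃ G : ℝ → ℝ → ℝ, Continuous (Function.uncurry G) ∧
      ∀ x ∈ Icc (0 : ℝ) 1, ∀ t ∈ Icc 0 T, G x t = g x t := by
  refine ⟨fun x t => g (projIcc 0 1 zero_le_one x) (projIcc 0 T hT t), ?_, fun x hx t ht => ?_⟩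
  · exact hg.comp_continuous (f := fun p : ℝ × ℝ =>
      ((projIcc 0 1 zero_le_one p.1 : ℝ), (projIcc 0 T hT p.2 : ℝ))) (by fun_prop)
      (fun p => ⟨Subtype.coe_prop _, Subtype.coe_prop _⟩)
  · simp only [projIcc_of_mem zero_le_one hx, projIcc_of_mem hT ht]

/-- Regular solutions have the coefficients `u0`, `u1`, `u2`. -/
theorem IsRegularSolution.eq_seriesSolution {α T C : ℝ} (hα1 : α < 1) (hT : 0 < T)
    {G v : ℝ → ℝ → ℝ} (hG : Continuous (Function.uncurry G)) (hv : IsRegularSolution α T G v)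
    (hb : ∀ k, ∀ t ∈ Icc 0 T, |u1 α G k t| ≤ C / den α k ∧ |u2 α G k t| ≤ C / den α k) :
    ∀ x ∈ Icc (0 : ℝ) 1, ∀ t ∈ Icc 0 T, v x t = seriesSolution α G x t := by
  obtain ⟨U, hU, hUv⟩ := exists_continuous_extension hT.le hv.cont
  have h1 : 1 - α ≠ 0 := (sub_pos.2 hα1).ne'
  have hell : ∀ t ∈ Ioo 0 T, EqOn (fun x => U x t)
      (fun x => U 0 t + antideriv2 (rhs α G U t) x) (Icc 0 1) := by
    intro t ht
    have ht' := Ioo_subset_Icc_self ht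
    have hvU : EqOn (fun x => U x t) (fun x => v x t) (Icc 0 1) := fun x hx => hUv x hx t ht'
    have hcl := eqOn_antideriv2_of_classical (continuous_rhs_space hG hU α t)
      (v := fun x => v x t) ((hv.cont.comp (f := fun x : ℝ => (x, t)) (by fun_prop)
        (fun x hx => ⟨hx, ht'⟩))) (hv.contDiff t ht) (fun x hx => by
        have hx' := Ioo_subset_Icc_self hx
        have e := hv.equation x hx t ht
        rw [cfDeriv_eq_memory (hv.absCont x hx) (hv.initial x hx') ht'] at e
        have hm : memory (α / (1 - α)) (U x) t = memory (α / (1 - α)) (v x) t :=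
          memory_congr (fun s hs => hUv x hx' s hs) ht'
        rw [rhs, hm, hUv x hx' t ht']
        linarith) (hv.neumann t ht)
    intro x hx
    have := hcl hx
    simp only at this ⊢
    rw [hUv x hx t ht', hUv 0 ⟨le_rfl, zero_le_one⟩ t ht', this]
  -- The nonlocal condition enters here, as the vanishing of the double primitive at `1`.
  have hV1 : ∀ t ∈ Ioo 0 T, antideriv2 (rhs α G U t) 1 = 0 := fun t ht => by
    have ht' := Ioo_subset_Icc_self ht
    have := hell t ht ⟨zero_le_one, le_rfl⟩
    simp only at this
    rw [hUv 0 ⟨le_rfl, zero_le_one⟩ t ht', hUv 1 ⟨zero_le_one, le_rfl⟩ t ht',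
      hv.nonlocal t ht'] at this
    linarith
  have hq : ∀ k : ℕ, 1 + freq k ^ 2 * (1 - α) ≠ 0 := fun k => by
    have := den_pos hα1 (sq_nonneg (freq k)); positivity
  -- Taking coefficients of the elliptic equation produces the same Volterra equation that `volt`
  -- solves; `e2` and `e1` repeat this, `e1` using `e2` for the coupling.
  have e0 : EqOn (g0 U) (u0 α G) (Icc 0 T) := by
    rw [u0_eq_volt]
    refine eq_of_volterra (q := 1 + 0 * (1 - α)) (b := 1 - α) (a := α / (1 - α)) (f := g0 G)
      (continuous_g0 hU) (continuous_volt (continuous_g0 hG) α 0) (by simp)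
      (fun t ht => ?_) (fun t ht => volt_volterra hα1 le_rfl (continuous_g0 hG) ht.1.le) hT
    have e := coef0_antideriv2 (continuous_rhs_space hG hU α t)
    rw [hV1 t ht, coef0_rhs hG hU, sub_eq_iff_eq_add, div_eq_iff h1] at e
    linear_combination e
  have e2 : ∀ k, EqOn (g2 U k) (u2 α G k) (Icc 0 T) := by
    intro k
    rw [u2_eq_volt]
    refine eq_of_volterra (b := 1 - α) (a := α / (1 - α)) (f := g2 G k)
      (continuous_g2 hU k) (continuous_volt (continuous_g2 hG k) _ _) (hq k)
      (fun t ht => ?_)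
      (fun t ht => volt_volterra hα1 (sq_nonneg _) (continuous_g2 hG k) ht.1.le) hT
    have e := coef2_antideriv2 (continuous_rhs_space hG hU α t) (hV1 t ht) (U 0 t) k
    rw [← (coef_congr (hell t ht)).2.2, coef2_rhs hG hU, sub_eq_iff_eq_add, div_eq_iff h1] at e
    have : coef2 (fun x => U x t) k = g2 U k t := rfl
    rw [this] at e
    linear_combination e
  have e1 : ∀ k, EqOn (g1 U k) (u1 α G k) (Icc 0 T) := by
    intro k
    rw [u1_eq_volt hG]
    refine eq_of_volterra (b := 1 - α) (a := α / (1 - α))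
      (f := fun t => g1 G k t + 4 * k * π * u2 α G k t)
      (continuous_g1 hU k) (continuous_volt (continuous_rhs hG α k) _ _) (hq k)
      (fun t ht => ?_)
      (fun t ht => volt_volterra hα1 (sq_nonneg _) (continuous_rhs hG α k) ht.1.le) hT
    have e := coef1_antideriv2 (continuous_rhs_space hG hU α t) (hV1 t ht) (U 0 t) k
    rw [← (coef_congr (hell t ht)).2.2, ← (coef_congr (hell t ht)).2.1, coef1_rhs hG hU,
      sub_eq_iff_eq_add, div_eq_iff h1] at e
    have c2 : coef2 (fun x => U x t) k = g2 U k t := rfl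
    have c1 : coef1 (fun x => U x t) k = g1 U k t := rfl
    rw [c1, c2, e2 k (Ioo_subset_Icc_self ht)] at e
    have hf : 4 * k * π = 2 * freq k := by unfold freq; ring
    rw [hf]
    linear_combination e
  intro x hx t ht
  have hA := summable_abs_of_le_div_den hα1 (A := fun k => u1 α G (k + 1) t)
    (fun k => (hb (k + 1) t ht).1)
  have hB := summable_abs_of_le_div_den hα1 (A := fun k => u2 α G (k + 1) t)
    (fun k => (hb (k + 1) t ht).2)
  have hUt : Continuous fun x => U x t := hU.comp (by fun_prop : Continuous fun x : ℝ => (x, t))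
  rw [← hUv x hx t ht]
  refine eqOn_of_coef_eq (f := fun x => U x t) hUt.continuousOn (continuous_series hA hB) ?_
    (series_zero_eq_one _ _ _) ?_ (fun k hk => ?_) (fun k hk => ?_) hx
  · rw [hUv 0 ⟨le_rfl, zero_le_one⟩ t ht, hUv 1 ⟨zero_le_one, le_rfl⟩ t ht, hv.nonlocal t ht]
  · rw [coef0_series hA hB]; exact e0 ht
  · obtain ⟨j, rfl⟩ := Nat.exists_eq_add_of_le' hk
    rw [coef1_series hA hB]; exact e1 _ ht
  · obtain ⟨j, rfl⟩ := Nat.exists_eq_add_of_le' hk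
    rw [coef2_series hA hB]; exact e2 _ ht

theorem volt_zero {α μ : ℝ} {f : ℝ → ℝ} (h : f 0 = 0) : volt α μ f 0 = 0 := by
  simp [volt, memory_zero, h]

section Initial

variable {G : ℝ → ℝ → ℝ}

theorem g_initial (h : ∀ x ∈ Icc (0 : ℝ) 1, G x 0 = 0) :
    g0 G 0 = 0 ∧ ∀ k, g1 G k 0 = 0 ∧ g2 G k 0 = 0 := by
  have e := coef_congr (f := fun x => G x 0) (h := fun _ => 0) h
  have z0 : coef0 (fun _ => 0) = 0 := by simp [coef0]
  have z1 : ∀ k, coef1 (fun _ => 0) k = 0 := fun k => by simp [coef1]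
  have z2 : ∀ k, coef2 (fun _ => 0) k = 0 := fun k => by simp [coef2]
  exact ⟨e.1.trans z0, fun k => ⟨(congrFun e.2.1 k).trans (z1 k), (congrFun e.2.2 k).trans (z2 k)⟩⟩

theorem u_initial (hG : Continuous (Function.uncurry G)) (α : ℝ)
    (h : ∀ x ∈ Icc (0 : ℝ) 1, G x 0 = 0) :
    u0 α G 0 = 0 ∧ ∀ k, u1 α G k 0 = 0 ∧ u2 α G k 0 = 0 := by
  obtain ⟨z0, z⟩ := g_initial h
  have z2 : ∀ k, u2 α G k 0 = 0 := fun k => by rw [u2_eq_volt]; exact volt_zero (z k).2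
  refine ⟨by rw [u0_eq_volt]; exact volt_zero z0, fun k => ⟨?_, z2 k⟩⟩
  rw [u1_eq_volt hG]
  exact volt_zero (by rw [(z k).1, z2 k]; simp)

end Initial

/-- The series of root functions is a regular solution. -/
theorem isRegularSolution_seriesSolution {α T C : ℝ} (hα1 : α < 1) (hT : 0 < T)
    {G : ℝ → ℝ → ℝ} (hG : Continuous (Function.uncurry G))
    (hG0 : ∀ x ∈ Icc (0 : ℝ) 1, G x 0 = 0) {H : ℝ → ℝ} (hH : AbsolutelyContinuousOnInterval H 0 T)
    (hb : ∀ k, ∀ t ∈ Icc 0 T, |u1 α G k t| ≤ C / den α k ∧ |u2 α G k t| ≤ C / den α k)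
    (hi : ∀ s ∈ Icc 0 T, ∀ t ∈ Icc 0 T, s ≤ t → |u0 α G t - u0 α G s| ≤ H t - H s ∧
        ∀ k, |u1 α G k t - u1 α G k s| ≤ (H t - H s) / den α k ∧
          |u2 α G k t - u2 α G k s| ≤ (H t - H s) / den α k) :
    IsRegularSolution α T G (seriesSolution α G) := by
  have h1 : 1 - α ≠ 0 := (sub_pos.2 hα1).ne'
  have hA : ∀ t ∈ Icc 0 T, Summable fun k => |u1 α G (k + 1) t| := fun t ht =>
    summable_abs_of_le_div_den hα1 fun k => (hb (k + 1) t ht).1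
  have hB : ∀ t ∈ Icc 0 T, Summable fun k => |u2 α G (k + 1) t| := fun t ht =>
    summable_abs_of_le_div_den hα1 fun k => (hb (k + 1) t ht).2
  have hsumC : ∀ c, Summable fun k => c / den α (k + 1) := fun c => by
    simpa [div_eq_mul_inv] using (summable_one_div_den hα1).mul_left c
  have hcont : ContinuousOn (fun p : ℝ × ℝ => seriesSolution α G p.1 p.2)
      (Icc 0 1 ×ˢ Icc 0 T) := by
    have cu0 := continuous_u0 hG α
    have c1 : ContinuousOn (fun p : ℝ × ℝ =>
        ∑' k : ℕ, u1 α G (k + 1) p.2 * cos (freq (k + 1) * p.1)) (Icc 0 1 ×ˢ Icc 0 T) :=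
      continuousOn_tsum (fun k => by have := continuous_u1 hG α (k + 1); fun_prop) (hsumC C)
        (fun k p hp => (norm_eq_abs _).trans_le ((abs_mul_cos_le (u1 α G (k + 1) p.2)
          (freq (k + 1) * p.1)).trans (hb (k + 1) p.2 hp.2).1))
    have c2 : ContinuousOn (fun p : ℝ × ℝ =>
        ∑' k : ℕ, u2 α G (k + 1) p.2 * (p.1 * sin (freq (k + 1) * p.1))) (Icc 0 1 ×ˢ Icc 0 T) :=
      continuousOn_tsum (fun k => by have := continuous_u2 hG α (k + 1); fun_prop) (hsumC C)
        (fun k p hp => (norm_eq_abs _).trans_le ((abs_mul_mul_sin_le (u2 α G (k + 1) p.2)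
          (freq (k + 1) * p.1) hp.1).trans (hb (k + 1) p.2 hp.2).2))
    exact ((by fun_prop : ContinuousOn (fun p : ℝ × ℝ => u0 α G p.2) _).add c1).add c2
  have hac : ∀ x ∈ Icc (0 : ℝ) 1, AbsolutelyContinuousOnInterval (seriesSolution α G x) 0 T := by
    intro x hx
    refine absolutelyContinuous_of_dominated hT.le
      (hH.const_mul (1 + 2 * ∑' k, 1 / den α (k + 1))) (fun s hs t ht hst => ?_)
    obtain ⟨i0, ik⟩ := hi s hs t ht hst
    refine (abs_series_sub_le (hA t ht) (hB t ht) (hA s hs) (hB s hs) (hsumC (H t - H s))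
      (fun k => (ik (k + 1)).1) (fun k => (ik (k + 1)).2) hx).trans ?_
    have : ∑' k, (H t - H s) / den α (k + 1) = (H t - H s) * ∑' k, 1 / den α (k + 1) := by
      rw [← tsum_mul_left]; congr 1; ext k; ring
    rw [this]
    linarith
  have hinit : ∀ x, seriesSolution α G x 0 = 0 := by
    intro x
    obtain ⟨z0, z⟩ := u_initial hG α hG0
    simp [seriesSolution, series, z0, z]
  obtain ⟨U, hU, hUu⟩ := exists_continuous_extension hT.le hcont
  have hcoef : ∀ t ∈ Icc 0 T, g0 U t = u0 α G t ∧
      ∀ k, 1 ≤ k → g1 U k t = u1 α G k t ∧ g2 U k t = u2 α G k t := by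
    intro t ht
    have e := coef_congr (f := fun x => U x t) (h := fun x => seriesSolution α G x t)
      (fun x hx => hUu x hx t ht)
    refine ⟨e.1.trans (coef0_series (hA t ht) (hB t ht)), fun k hk => ?_⟩
    obtain ⟨j, rfl⟩ := Nat.exists_eq_add_of_le' hk
    exact ⟨(congrFun e.2.1 _).trans (coef1_series (hA t ht) (hB t ht) j),
      (congrFun e.2.2 _).trans (coef2_series (hA t ht) (hB t ht) j)⟩
  have hR := fun t => continuous_rhs_space hG hU α t
  -- No termwise differentiation: the Volterra equations for `u0`, `u1`, `u2` are exactly the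
  -- coefficient relations between the sum and `rhs`.
  have hell : ∀ t ∈ Icc 0 T, EqOn (fun x => seriesSolution α G x t)
      (fun x => seriesSolution α G 0 t + antideriv2 (rhs α G U t) x) (Icc 0 1) := by
    intro t ht
    obtain ⟨q0, qk⟩ := hcoef t ht
    refine eqOn_antideriv2_of_coef (hR t) (continuous_series (hA t ht) (hB t ht))
      (series_zero_eq_one _ _ _) ?_ (fun k hk => ?_) (fun k hk => ?_)
    · have hm := memory_congr (a := α / (1 - α)) (fun s hs => (hcoef s hs).1) ht
      have e := volt_volterra hα1 le_rfl (continuous_g0 hG) ht.1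
      rw [← u0_eq_volt] at e
      rw [coef0_rhs hG hU, q0, hm, sub_eq_zero, div_eq_iff h1]
      linear_combination e
    · have hm := memory_congr (a := α / (1 - α)) (fun s hs => ((hcoef s hs).2 k hk).2) ht
      have e := volt_volterra hα1 (sq_nonneg (freq k)) (continuous_g2 hG k) ht.1
      rw [← u2_eq_volt] at e
      have e' : coef2 (fun x => seriesSolution α G x t) k = u2 α G k t := by
        obtain ⟨j, rfl⟩ := Nat.exists_eq_add_of_le' hk
        exact coef2_series (hA t ht) (hB t ht) j
      rw [coef2_rhs hG hU, (qk k hk).2, hm, e', sub_eq_iff_eq_add, div_eq_iff h1]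
      linear_combination e
    · have hm := memory_congr (a := α / (1 - α)) (fun s hs => ((hcoef s hs).2 k hk).1) ht
      have e := volt_volterra hα1 (sq_nonneg (freq k)) (continuous_rhs hG α k) ht.1
      rw [← u1_eq_volt hG] at e
      have e2 : coef2 (fun x => seriesSolution α G x t) k = u2 α G k t := by
        obtain ⟨j, rfl⟩ := Nat.exists_eq_add_of_le' hk
        exact coef2_series (hA t ht) (hB t ht) j
      have e1 : coef1 (fun x => seriesSolution α G x t) k = u1 α G k t := by
        obtain ⟨j, rfl⟩ := Nat.exists_eq_add_of_le' hk
        exact coef1_series (hA t ht) (hB t ht) j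
      have hf : 4 * k * π = 2 * freq k := by unfold freq; ring
      rw [hf] at e
      rw [coef1_rhs hG hU, (qk k hk).1, hm, e1, e2, sub_eq_iff_eq_add, div_eq_iff h1]
      linear_combination e
  have hxx : ∀ t ∈ Icc 0 T, ∀ x ∈ Ioo (0 : ℝ) 1,
      iteratedDeriv 2 (fun y => seriesSolution α G y t) x = rhs α G U t x := by
    intro t ht x hx
    have hev : (fun y => seriesSolution α G y t) =ᶠ[nhds x]
        fun y => seriesSolution α G 0 t + antideriv2 (rhs α G U t) y := by
      filter_upwards [Ioo_mem_nhds hx.1 hx.2] with y hy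
      exact hell t ht (Ioo_subset_Icc_self hy)
    rw [hev.iteratedDeriv_eq, iteratedDeriv_const_add (by norm_num),
      iteratedDeriv_two_antideriv2 (hR t)]
  refine ⟨hcont, fun x hx => hac x (Ioo_subset_Icc_self hx), fun t ht => ?_, ?_,
    fun x hx t ht => ?_, fun x _ => hinit x, fun t _ => series_zero_eq_one _ _ _, fun t ht => ?_⟩
  · exact (contDiff_const.add (contDiff_antideriv2 (hR t))).contDiffOn.congr
      (fun x hx => hell t (Ioo_subset_Icc_self ht) (Ioo_subset_Icc_self hx))
  -- Continuity of `u_xx` is read off from `rhs`, which involves no derivatives.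
  · have hcr : Continuous fun p : ℝ × ℝ => rhs α G U p.2 p.1 := by
      have hcm : Continuous fun p : ℝ × ℝ => memory (α / (1 - α)) (U p.1) p.2 := by
        refine continuous_parametric_intervalIntegral_of_continuous
          (f := fun (p : ℝ × ℝ) s => U p.1 s * exp (-(α / (1 - α)) * (p.2 - s))) ?_ continuous_snd
        have hU' : Continuous fun p : ℝ × ℝ => U p.1 p.2 := hU
        have : Continuous fun p : (ℝ × ℝ) × ℝ => U p.1.1 p.2 :=
          hU'.comp (by fun_prop : Continuous fun p : (ℝ × ℝ) × ℝ => (p.1.1, p.2))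
        simp only [Function.uncurry_def]
        fun_prop
      have hU' : Continuous fun p : ℝ × ℝ => U p.1 p.2 := hU
      have hG' : Continuous fun p : ℝ × ℝ => G p.1 p.2 := hG
      unfold rhs
      fun_prop
    exact hcr.continuousOn.congr fun p hp => hxx p.2 (Ioo_subset_Icc_self hp.2) p.1 hp.1
  · have ht' := Ioo_subset_Icc_self ht
    have hx' := Ioo_subset_Icc_self hx
    have hm : memory (α / (1 - α)) (U x) t = memory (α / (1 - α)) (seriesSolution α G x) t :=
      memory_congr (fun s hs => hUu x hx' s hs) ht'
    rw [cfDeriv_eq_memory (hac x hx') (hinit x) ht', hxx t ht' x hx, rhs, hUu x hx' t ht', hm]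
    ring
  · have hd := ((hasDerivAt_antideriv2 (hR t) 0).const_add
      (seriesSolution α G 0 t)).hasDerivWithinAt (s := Icc 0 1)
    rw [integral_same] at hd
    exact hd.congr (hell t (Ioo_subset_Icc_self ht))
      (hell t (Ioo_subset_Icc_self ht) ⟨le_rfl, zero_le_one⟩)

/-! ### Restriction to the rectangle -/

section Congr

variable {α T : ℝ} {g G : ℝ → ℝ → ℝ}

theorem IsRegularSolution.congr_source (hGg : ∀ x ∈ Icc (0 : ℝ) 1, ∀ t ∈ Icc 0 T, G x t = g x t)
    {u : ℝ → ℝ → ℝ} (hu : IsRegularSolution α T G u) : IsRegularSolution α T g u :=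
  { hu with
    equation := fun x hx t ht => (hu.equation x hx t ht).trans
      (hGg x (Ioo_subset_Icc_self hx) t (Ioo_subset_Icc_self ht)) }

theorem g_congr (hGg : ∀ x ∈ Icc (0 : ℝ) 1, ∀ t ∈ Icc 0 T, G x t = g x t) :
    EqOn (g0 g) (g0 G) (Icc 0 T) ∧
      ∀ k, EqOn (g1 g k) (g1 G k) (Icc 0 T) ∧ EqOn (g2 g k) (g2 G k) (Icc 0 T) := by
  have e := fun t (ht : t ∈ Icc 0 T) => coef_congr (f := fun x => g x t) (h := fun x => G x t)
    (fun x hx => (hGg x hx t ht).symm)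
  exact ⟨fun t ht => (e t ht).1, fun k => ⟨fun t ht => congrFun (e t ht).2.1 k,
    fun t ht => congrFun (e t ht).2.2 k⟩⟩

theorem u_congr (hGg : ∀ x ∈ Icc (0 : ℝ) 1, ∀ t ∈ Icc 0 T, G x t = g x t) :
    EqOn (u0 α g) (u0 α G) (Icc 0 T) ∧
      ∀ k, EqOn (u1 α g k) (u1 α G k) (Icc 0 T) ∧ EqOn (u2 α g k) (u2 α G k) (Icc 0 T) := by
  obtain ⟨e0, ek⟩ := g_congr hGg
  have hI : ∀ t ∈ Icc 0 T, ∀ z ∈ uIcc 0 t, z ∈ Icc 0 T := fun t ht z hz => by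
    rw [uIcc_of_le ht.1] at hz; exact ⟨hz.1, hz.2.trans ht.2⟩
  refine ⟨fun t ht => ?_, fun k => ⟨fun t ht => ?_, fun t ht => ?_⟩⟩
  · simp only [u0, e0 ht]
    rw [integral_congr fun z hz => e0 (hI t ht z hz)]
  · simp only [u1, (ek k).1 ht, (ek k).2 ht]
    congr 2
    exact integral_congr fun z hz => by
      simp only [(ek k).1 (hI t ht z hz), (ek k).2 (hI t ht z hz)]
  · simp only [u2, (ek k).2 ht]
    congr 2
    exact integral_congr fun z hz => by simp only [(ek k).2 (hI t ht z hz)]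

/-- The coefficient functions of a continuous source solve their initial value problems. -/
theorem existsUnique_ivp (hα1 : α < 1) {μ : ℝ} (hμ : 0 ≤ μ) (hT : 0 < T) {f f' u u' : ℝ → ℝ}
    (hf : Continuous f) (hf0 : f 0 = 0) (hu : u = volt α μ f)
    (hac : AbsolutelyContinuousOnInterval u 0 T) (hff : EqOn f' f (Icc 0 T))
    (huu : EqOn u' u (Icc 0 T)) :
    IsIVPSolution α μ T f' u' ∧ ∀ y, IsIVPSolution α μ T f' y → EqOn y u' (Icc 0 T) := by
  subst hu
  exact ⟨(isIVPSolution_volt hα1 hμ hf hf0 hac).congr hT.le hff huu, fun y hy =>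
    ((hy.congr hT.le hff.symm fun _ _ => rfl).eqOn_volt hα1 hμ hT hf).trans huu.symm⟩

end Congr

end CFHeat

end

/-! ### Assembly: passing to a continuous extension of the source and back -/

theorem theorem5 (α T : ℝ) (hα : 0 < α) (hα1 : α < 1) (hT : 0 < T) (g : ℝ → ℝ → ℝ)
    (hg : ContinuousOn (fun p : ℝ × ℝ => g p.1 p.2) (Icc 0 1 ×ˢ Icc 0 T))
    (hg_init : ∀ x ∈ Icc (0 : ℝ) 1, g x 0 = 0)
    (hg_bdry : ∀ t ∈ Icc (0 : ℝ) T, g 0 t = g 1 t)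
    (hgt_ac : ∀ᵐ x ∂(volume.restrict (Icc (0 : ℝ) 1)), AbsolutelyContinuousOnInterval (g x) 0 T)
    (hgt : IntegrableOn (fun p : ℝ × ℝ => deriv (g p.1) p.2) (Ioo 0 1 ×ˢ Ioo 0 T))
    (hgx : ∀ᵐ t ∂(volume.restrict (Icc (0 : ℝ) T)),
      AbsolutelyContinuousOnInterval (fun x => g x t) 0 1 ∧
        MemLp (deriv fun x => g x t) 2 (volume.restrict (Ioo (0 : ℝ) 1))) :
    ∃ u : ℝ → ℝ → ℝ,
      CFHeat.IsRegularSolution α T g u ∧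
      (∀ v : ℝ → ℝ → ℝ, CFHeat.IsRegularSolution α T g v →
        ∀ x ∈ Icc (0 : ℝ) 1, ∀ t ∈ Icc (0 : ℝ) T, v x t = u x t) ∧
      (∀ x ∈ Icc (0 : ℝ) 1, ∀ t ∈ Icc (0 : ℝ) T,
        Summable (fun k : ℕ =>
          CFHeat.u1 α g (k + 1) t * Real.cos (CFHeat.freq (k + 1) * x)) ∧
        Summable (fun k : ℕ =>
          CFHeat.u2 α g (k + 1) t * (x * Real.sin (CFHeat.freq (k + 1) * x))) ∧
        u x t = CFHeat.u0 α g t +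
          (∑' k : ℕ, CFHeat.u1 α g (k + 1) t * Real.cos (CFHeat.freq (k + 1) * x)) +
          ∑' k : ℕ, CFHeat.u2 α g (k + 1) t * (x * Real.sin (CFHeat.freq (k + 1) * x))) ∧
      (CFHeat.IsIVPSolution α 0 T (CFHeat.g0 g) (CFHeat.u0 α g) ∧
        ∀ y, CFHeat.IsIVPSolution α 0 T (CFHeat.g0 g) y →
          EqOn y (CFHeat.u0 α g) (Icc 0 T)) ∧
      (∀ k : ℕ, 1 ≤ k →
        (CFHeat.IsIVPSolution α (CFHeat.freq k ^ 2) T (CFHeat.g2 g k) (CFHeat.u2 α g k) ∧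
          ∀ y, CFHeat.IsIVPSolution α (CFHeat.freq k ^ 2) T (CFHeat.g2 g k) y →
            EqOn y (CFHeat.u2 α g k) (Icc 0 T)) ∧
        (CFHeat.IsIVPSolution α (CFHeat.freq k ^ 2) T
            (fun t => CFHeat.g1 g k t + 4 * k * Real.pi * CFHeat.u2 α g k t)
            (CFHeat.u1 α g k) ∧
          ∀ y, CFHeat.IsIVPSolution α (CFHeat.freq k ^ 2) T
              (fun t => CFHeat.g1 g k t + 4 * k * Real.pi * CFHeat.u2 α g k t) y →
            EqOn y (CFHeat.u1 α g k) (Icc 0 T))) := by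
  obtain ⟨G, hG, hGg⟩ := CFHeat.exists_continuous_extension hT.le hg
  obtain ⟨F, hF, hgF⟩ := CFHeat.exists_increment_bound hT hg hgt_ac hgt
  have hGF : ∀ s ∈ Icc 0 T, ∀ t ∈ Icc 0 T, s ≤ t →
      ∫ x in (0 : ℝ)..1, |G x t - G x s| ≤ F t - F s := fun s hs t ht hst => by
    refine le_trans (le_of_eq (intervalIntegral.integral_congr fun x hx => ?_)) (hgF s hs t ht hst)
    rw [uIcc_of_le zero_le_one] at hx
    simp only [hGg x hx t ht, hGg x hx s hs]
  have hG0 : ∀ x ∈ Icc (0 : ℝ) 1, G x 0 = 0 := fun x hx =>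
    (hGg x hx 0 ⟨le_rfl, hT.le⟩).trans (hg_init x hx)
  obtain ⟨M, hM⟩ := (isCompact_Icc.prod isCompact_Icc).exists_bound_of_continuousOn hg
  have hGM : ∀ x ∈ Icc (0 : ℝ) 1, ∀ t ∈ Icc 0 T, |G x t| ≤ M := fun x hx t ht => by
    rw [hGg x hx t ht]
    exact hM (x, t) ⟨hx, ht⟩
  obtain ⟨C, H, hH, hb, hi⟩ := CFHeat.exists_coefficient_bounds hα hα1 hT hG hGM hF hGF
  have hGg' : ∀ x ∈ Icc (0 : ℝ) 1, ∀ t ∈ Icc 0 T, g x t = G x t := fun x hx t ht =>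
    (hGg x hx t ht).symm
  obtain ⟨eg0, eg⟩ := CFHeat.g_congr hGg
  obtain ⟨eu0, eu⟩ := CFHeat.u_congr (α := α) hGg
  obtain ⟨zg0, zg⟩ := CFHeat.g_initial hG0
  obtain ⟨-, zu⟩ := CFHeat.u_initial hG α hG0
  -- These functions dominate the increments of the `k`-th coefficients, which gives their absolute
  -- continuity.
  have hac : ∀ k, AbsolutelyContinuousOnInterval (fun t => 1 / CFHeat.den α k * H t) 0 T :=
    fun k => hH.const_mul _
  refine ⟨CFHeat.seriesSolution α G,
    (CFHeat.isRegularSolution_seriesSolution hα1 hT hG hG0 hH hb hi).congr_source hGg,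
    fun v hv => (hv.congr_source hGg').eq_seriesSolution hα1 hT hG hb,
    fun x hx t ht => ?_, ?_, fun k hk => ⟨?_, ?_⟩⟩
  · have e1 : ∀ k, CFHeat.u1 α g k t = CFHeat.u1 α G k t := fun k => (eu k).1 ht
    have e2 : ∀ k, CFHeat.u2 α g k t = CFHeat.u2 α G k t := fun k => (eu k).2 ht
    simp only [e1, e2, eu0 ht]
    exact ⟨CFHeat.summable_mul_cos (CFHeat.summable_abs_of_le_div_den hα1
      fun k => (hb (k + 1) t ht).1) x, CFHeat.summable_mul_mul_sin
      (CFHeat.summable_abs_of_le_div_den hα1 fun k => (hb (k + 1) t ht).2) hx, rfl⟩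
  · exact CFHeat.existsUnique_ivp hα1 le_rfl hT (CFHeat.continuous_g0 hG) zg0
      (CFHeat.u0_eq_volt α G) (CFHeat.absolutelyContinuous_of_dominated hT.le hH
        fun s hs t ht hst => (hi s hs t ht hst).1) eg0 eu0
  · exact CFHeat.existsUnique_ivp hα1 (sq_nonneg _) hT (CFHeat.continuous_g2 hG k) (zg k).2
      (CFHeat.u2_eq_volt α G k) (CFHeat.absolutelyContinuous_of_dominated hT.le (hac k)
        fun s hs t ht hst => (((hi s hs t ht hst).2 k).2).trans_eq (by ring)) (eg k).2 (eu k).2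
  · exact CFHeat.existsUnique_ivp hα1 (sq_nonneg _) hT (CFHeat.continuous_rhs hG α k)
      (by rw [(zg k).1, (zu k).2]; simp) (CFHeat.u1_eq_volt hG α k)
      (CFHeat.absolutelyContinuous_of_dominated hT.le (hac k)
        fun s hs t ht hst => (((hi s hs t ht hst).2 k).1).trans_eq (by ring))
      (fun t ht => by simp only [(eg k).1 ht, (eu k).2 ht]) (eu k).1
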